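/- Let $d\ge 5$ and $\mathbb T^d=\mathbb R^d/\mathbb Z^d$; functions on $\mathbb T^d$ are identified with $\mathbb Z^d$-periodic functions on $\mathbb R^d$, and integrals over $\mathbb T^d$ are taken over $[-\tfrac12,\tfrac12)^d$. For $u\in C^\infty(\mathbb T^d)$ put $\widehat u(\nu)=\int_{\mathbb T^d}u(z)e^{-2\pi i\nu\cdot z}\,dz$ for $\nu\in\mathbb Z^d$, and $$\Delta^{-2}u(x)=\sum_{\nu\in\mathbb Z^d\setminus\{0\}}\|\nu\|^{-4}\,\widehat u(\nu)\,e^{2\pi i\nu\cdot x}$$ ($\|\cdot\|$ is the Euclidean norm; note that the Laplacian is normalized to have the eigenvalues $-\|\nu\|^2$, without the factor $4\pi^2$). Let $\Xi$ denote the bilaplacian field on $\mathbb T^d$: a process $(\langle\Xi,u\rangle)$, indexed by the real-valued $u\in C^\infty(\mathbb T^d)$ with $\int_{\mathbb T^d}u=0$ and almost surely linear in $u$, such that $\langle\Xi,u\rangle$ is a centered Gaussian variable with variance $(u,\Delta^{-2}u)_{L^2(\mathbb T^d)}$. Then there exist functions $\mathcal G_d\in L^1(\mathbb R^d)$ and $h_d\in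 C^\infty(\mathbb R^d)$, real-valued and depending only on $d$, such that $$\mathcal G_d(x)=\pi^{4-\frac d2}\,\Gamma\!\left(\tfrac{d-4}{2}\right)\|x\|^{4-d}+h_d(x)\qquad(x\ne 0),$$ the series $\sum_{w\in\mathbb Z^d}\mathcal G_d(x+w)$ converges absolutely for every $x\in\mathbb R^d\setminus\mathbb Z^d$, and for every real-valued $u\in C^\infty(\mathbb T^d)$ with $\int_{\mathbb T^d}u(x)\,dx=0$ $$\mathsf E\big[\langle\Xi,u\rangle^2\big]=\big(u,\Delta^{-2}u\big)_{L^2(\mathbb T^d)}=\iint_{\mathbb T^d\times\mathbb T^d}u(z)\,u(z')\sum_{w\in\mathbb Z^d}\mathcal G_d(z-z'+w)\,dz\,dz',$$ where the integrand of the double integral is absolutely integrable. -/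

import Mathlib

open MeasureTheory ProbabilityTheory
open scoped ContDiff

namespace TorusBilaplacian

/-- The point of `ℝ^d` given by an element of `ℤ^d`. -/
def latticePt {d : ℕ} (w : Fin d → ℤ) : EuclideanSpace ℝ (Fin d) :=
  WithLp.toLp 2 (fun i => (w i : ℝ))

/-- The cube `[-1/2, 1/2)^d`, the fundamental domain over which integrals on the torus
`𝕋^d = ℝ^d / ℤ^d` are computed. -/
def cell (d : ℕ) : Set (EuclideanSpace ℝ (Fin d)) :=
  {x | ∀ i, x i ∈ Set.Ico (-(1 / 2) : ℝ) (1 / 2)}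

theorem integrableOn_cell {d : ℕ} {u : EuclideanSpace ℝ (Fin d) → ℝ} (hu : Continuous u) :
    IntegrableOn u (cell d) := by
  let e := (EuclideanSpace.equiv (Fin d) ℝ).symm
  have hK : IsCompact (e '' (Set.univ.pi fun _ : Fin d => Set.Icc (-(1 / 2) : ℝ) (1 / 2))) :=
    (isCompact_univ_pi fun _ => isCompact_Icc).image e.continuous
  refine (hu.continuousOn.integrableOn_compact hK).mono_set ?_
  intro x hx
  refine ⟨(EuclideanSpace.equiv (Fin d) ℝ) x, ?_, ?_⟩
  · intro i _
    exact ⟨(hx i).1, (hx i).2.le⟩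
  · simp [e]

/-- The real vector space of the smooth real functions on `𝕋^d` (smooth `ℤ^d`-periodic functions
on `ℝ^d`) with zero average. -/
def ZeroAvgSmooth (d : ℕ) : Submodule ℝ (EuclideanSpace ℝ (Fin d) → ℝ) where
  carrier := {u | ContDiff ℝ ∞ u ∧ (∀ x (w : Fin d → ℤ), u (x + latticePt w) = u x) ∧
    ∫ x in cell d, u x = 0}
  zero_mem' := ⟨contDiff_const, fun _ _ => rfl, by simp⟩
  add_mem' := by
    rintro u v ⟨hu, pu, iu⟩ ⟨hv, pv, iv⟩
    refine ⟨hu.add hv, fun x w => by simp [pu x w, pv x w], ?_⟩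
    simp only [Pi.add_apply]
    rw [integral_add (integrableOn_cell hu.continuous) (integrableOn_cell hv.continuous), iu, iv,
      add_zero]
  smul_mem' := by
    rintro c u ⟨hu, pu, iu⟩
    refine ⟨hu.const_smul c, fun x w => by simp [pu x w], ?_⟩
    simp only [Pi.smul_apply, smul_eq_mul]
    rw [integral_const_mul, iu, mul_zero]

noncomputable section

/-- The character `e_ν(x) = exp(2πi ν·x)` of the torus. -/
def torusChar {d : ℕ} (ν : Fin d → ℤ) (x : EuclideanSpace ℝ (Fin d)) : ℂ :=
  Complex.exp (2 * Real.pi * Complex.I * (inner ℝ (latticePt ν) x : ℝ))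

/-- The Fourier coefficient `∫_{𝕋^d} u(z) exp(-2πi ν·z) dz`. -/
def torusFourier {d : ℕ} (u : EuclideanSpace ℝ (Fin d) → ℂ) (ν : Fin d → ℤ) : ℂ :=
  ∫ z in cell d, u z * torusChar (-ν) z

/-- The power `(-Δ)^a`, with the normalization in which `e_ν`, `ν ≠ 0`, has the eigenvalue
`‖ν‖^{2a}` (Euclidean norm), and constants are sent to `0`. For smooth `u` the series converges
absolutely at every point. -/
def negLaplacianPow {d : ℕ} (a : ℝ) (u : EuclideanSpace ℝ (Fin d) → ℂ)
    (x : EuclideanSpace ℝ (Fin d)) : ℂ :=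
  ∑' ν : {ν : Fin d → ℤ // ν ≠ 0},
    ((‖latticePt ν.1‖ ^ (2 * a) : ℝ) : ℂ) * torusFourier u ν.1 * torusChar ν.1 x

/-- The inverse `Δ^{-2} = (-Δ)^{-2}` of the bilaplacian. -/
def invBilaplacian {d : ℕ} (u : EuclideanSpace ℝ (Fin d) → ℂ) :
    EuclideanSpace ℝ (Fin d) → ℂ :=
  negLaplacianPow (-2) u

/-- The inner product of `L²(𝕋^d)`. -/
def torusInner {d : ℕ} (f g : EuclideanSpace ℝ (Fin d) → ℂ) : ℂ :=
  ∫ x in cell d, f x * (starRingEnd ℂ) (g x)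

/-- The quadratic form `(u, Δ^{-2} u)_{L²(𝕋^d)}` at a real function `u`. -/
def invBilaplacianForm {d : ℕ} (u : EuclideanSpace ℝ (Fin d) → ℝ) : ℂ :=
  torusInner (fun x => (u x : ℂ)) (invBilaplacian fun x => (u x : ℂ))

end

/-- A process `Ξ`, indexed by the smooth functions with zero average on `𝕋^d`, is a (continuum)
bilaplacian field if it is almost surely linear in the test function and `⟨Ξ, u⟩` is a centered
Gaussian variable with variance `(u, Δ^{-2} u)_{L²(𝕋^d)}` for every `u`. By linearity the finite
dimensional distributions are then jointly Gaussian. -/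
structure IsBilaplacianField {d : ℕ} {Ω : Type*} [MeasurableSpace Ω] (P : Measure Ω)
    (Ξ : ZeroAvgSmooth d → Ω → ℝ) : Prop where
  linear : ∀ (a b : ℝ) (u v : ZeroAvgSmooth d),
    ∀ᵐ o ∂P, Ξ (a • u + b • v) o = a * Ξ u o + b * Ξ v o
  hasLaw : ∀ u : ZeroAvgSmooth d,
    HasLaw (Ξ u) (gaussianReal 0 (invBilaplacianForm u.1).re.toNNReal) P

end TorusBilaplacian

/-! The kernel is built from the heat semigroup. For `N = ‖ν‖² > 0`, `N⁻² = ∫_0^∞ s exp(-sN) ds`;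
with `s = 1/t` this is `∫_0^∞ t⁻³ exp(-N/t) dt`, split at `t = 1`. Short heat times, `t > 1`:
`exp(-N/t)` is, up to the factor `(πt)^(d/2)`, the Fourier transform of `exp(-π²t‖x‖²)`. Integrating
these Gaussians in `t` gives `shortKernel`, an integrable function whose transform at `ν ≠ 0` is
`N⁻²` minus the elementary remainder `heatTail N` (`latticeFourier_shortKernel`). Completing the
`t`-integral to `(0, ∞)` produces a Gamma integral, hence the multiple of `‖x‖^(4-d)`; the added
piece `lowerGamma` is smooth in `‖x‖²`. Long heat times: `heatTail` decays fast enough for its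
Fourier series to be a smooth periodic function. Multiplied by `cellBump`, whose translates form a
partition of unity, it becomes compactly supported on `ℝ^d` and keeps its Fourier data on the
lattice (`latticeFourier_longKernel`). The sum `greenKernel` thus has transform `‖ν‖⁻⁴` at every
nonzero lattice point. By unfolding and Fourier inversion of `u` (`periodization_form`), its
periodization acts on smooth `u` as the multiplier given by these values. The zero average removes
`ν = 0`, and the variance of the Gaussian law gives the field. -/

namespace TorusBilaplacian

open Filter Topology

/-! ### Tiling of space by the cell, and unfolding of integrals -/

section Lattice

variable {d : ℕ}

local notation "𝔼" => EuclideanSpace ℝ (Fin d)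

@[simp] lemma latticePt_apply (w : Fin d → ℤ) (i : Fin d) : latticePt w i = (w i : ℝ) := rfl

lemma latticePt_neg (w : Fin d → ℤ) : latticePt (-w) = -latticePt w := by
  ext i; simp

lemma latticePt_add (v w : Fin d → ℤ) : latticePt (v + w) = latticePt v + latticePt w := by
  ext i; simp

@[simp] lemma latticePt_zero : latticePt (0 : Fin d → ℤ) = 0 := by
  ext i; simp

lemma latticePt_injective : Function.Injective (latticePt (d := d)) := by
  intro v w h
  funext i
  have := congrArg (fun x : 𝔼 => x i) h
  simpa using this

lemma one_le_norm_latticePt {w : Fin d → ℤ} (hw : w ≠ 0) : 1 ≤ ‖latticePt w‖ := by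
  obtain ⟨i, hi⟩ := Function.ne_iff.1 hw
  refine le_trans ?_ (PiLp.norm_apply_le (latticePt w) i)
  rw [latticePt_apply, Real.norm_eq_abs, ← Int.cast_abs]
  exact_mod_cast Int.one_le_abs hi

/-- The cell is half-open, so rounding each coordinate selects the one translate containing a given
point. -/
lemma sub_latticePt_mem_cell (x : 𝔼) (w : Fin d → ℤ) :
    x - latticePt w ∈ cell d ↔ w = fun i => ⌊x i + 1 / 2⌋ := by
  constructor
  · intro h
    funext i
    obtain ⟨h1, h2⟩ := h i
    simp only [PiLp.sub_apply, latticePt_apply] at h1 h2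
    rw [eq_comm, Int.floor_eq_iff]
    constructor <;> linarith
  · rintro rfl i
    simp only [PiLp.sub_apply, latticePt_apply, Set.mem_Ico]
    have h1 := Int.floor_le (x i + 1 / 2)
    have h2 := Int.lt_floor_add_one (x i + 1 / 2)
    constructor <;> linarith

lemma cell_subset_closedBall : cell d ⊆ Metric.closedBall (0 : 𝔼) d := by
  intro x hx
  rw [mem_closedBall_zero_iff]
  refine (EuclideanSpace.norm_eq x).trans_le ?_
  refine (Real.sqrt_le_sqrt (Finset.sum_le_sum fun i _ => ?_ :
    _ ≤ ∑ _i : Fin d, (1 : ℝ))).trans ?_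
  · obtain ⟨h1, h2⟩ := hx i
    rw [Real.norm_eq_abs, sq_abs]
    nlinarith
  · rw [Finset.sum_const, Finset.card_univ, Fintype.card_fin, nsmul_eq_mul, mul_one]
    rw [Real.sqrt_le_left (by positivity)]
    exact_mod_cast Nat.le_self_pow two_ne_zero d

lemma measurableSet_cell : MeasurableSet (cell d) := by
  have : cell d = ⋂ i, (fun x : 𝔼 => x i) ⁻¹' Set.Ico (-(1 / 2) : ℝ) (1 / 2) := by
    ext x; simp [cell]
  rw [this]
  exact MeasurableSet.iInter fun i => (by fun_prop : Measurable fun x : 𝔼 => x i) measurableSet_Ico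

instance isFiniteMeasure_restrict_cell : IsFiniteMeasure (volume.restrict (cell d)) := by
  have h := integrableOn_cell (d := d) (u := fun _ => 1) continuous_const
  rw [IntegrableOn, integrable_const_iff] at h
  simpa using h

/-- The lattice translates of the cell tile the space. -/
lemma volume_eq_sum_map_cell :
    (volume : Measure 𝔼) =
      Measure.sum fun w : Fin d → ℤ => (volume.restrict (cell d)).map (· + latticePt w) := by
  have h1 : ∀ w : Fin d → ℤ, (volume.restrict (cell d)).map (· + latticePt w) =
      volume.restrict {x : 𝔼 | x - latticePt w ∈ cell d} := by
    intro w
    have hm : MeasurableSet {x : 𝔼 | x - latticePt w ∈ cell d} :=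
      (by fun_prop : Measurable fun x : 𝔼 => x - latticePt w) measurableSet_cell
    have := ((measurePreserving_add_right (volume : Measure 𝔼) (latticePt w)).restrict_preimage
      hm).map_eq
    rw [← this]
    congr 2
    ext x
    simp
  simp_rw [h1]
  rw [← Measure.restrict_iUnion]
  · have : (⋃ w : Fin d → ℤ, {x : 𝔼 | x - latticePt w ∈ cell d}) = Set.univ := by
      ext x
      simp [sub_latticePt_mem_cell]
    rw [this, Measure.restrict_univ]
  · intro v w hvw
    refine Set.disjoint_left.2 fun x hv hw => hvw ?_
    rw [Set.mem_ofPred_eq, sub_latticePt_mem_cell] at hv hw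
    rw [hv, hw]
  · intro w
    exact (by fun_prop : Measurable fun x : 𝔼 => x - latticePt w) measurableSet_cell

/-- Only the second variable is tiled: in the double integral over cells, one variable is unfolded
to the whole space and the other stays in the cell. -/
lemma prod_volume_eq_sum_map_cell {X : Type*} [MeasurableSpace X] (μ : Measure X) [SFinite μ] :
    μ.prod (volume : Measure 𝔼) =
      Measure.sum fun w : Fin d → ℤ =>
        (μ.prod (volume.restrict (cell d))).map (fun p => (p.1, p.2 + latticePt w)) := by
  conv_lhs => rw [volume_eq_sum_map_cell, Measure.prod_sum_right]
  congr 1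
  funext w
  have := Measure.map_prod_map μ (volume.restrict (cell d)) (measurable_id (α := X))
    (measurable_add_const (latticePt w))
  rw [Measure.map_id] at this
  rw [this]
  rfl

section Unfold

variable {V : Type*} [NormedAddCommGroup V]

lemma measurableEmbedding_add_latticePt (w : Fin d → ℤ) :
    MeasurableEmbedding (fun x : 𝔼 => x + latticePt w) :=
  (MeasurableEquiv.addRight (latticePt w)).measurableEmbedding

lemma unfold_integrable {f : 𝔼 → V} (hf : Integrable f) :
    (∀ w : Fin d → ℤ, IntegrableOn (fun x => f (x + latticePt w)) (cell d)) ∧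
      Summable fun w : Fin d → ℤ => ∫ x in cell d, ‖f (x + latticePt w)‖ := by
  rw [volume_eq_sum_map_cell, integrable_sum_measure_iff] at hf
  refine ⟨fun w => ((measurableEmbedding_add_latticePt w).integrable_map_iff).1 (hf.1 w), ?_⟩
  simpa only [(measurableEmbedding_add_latticePt _).integral_map] using hf.2

lemma hasSum_unfold [NormedSpace ℝ V] {f : 𝔼 → V} (hf : Integrable f) :
    HasSum (fun w : Fin d → ℤ => ∫ x in cell d, f (x + latticePt w)) (∫ x, f x) := by
  have hf' := hf
  rw [volume_eq_sum_map_cell] at hf'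
  have := hasSum_integral_measure hf'
  rw [← volume_eq_sum_map_cell] at this
  simpa only [(measurableEmbedding_add_latticePt _).integral_map] using this

lemma unfold_prod_integrable {X : Type*} [MeasurableSpace X] {μ : Measure X} [SFinite μ]
    {f : X × 𝔼 → V} (hf : Integrable f (μ.prod volume)) :
    (∀ w : Fin d → ℤ, Integrable (fun p : X × 𝔼 => f (p.1, p.2 + latticePt w))
      (μ.prod (volume.restrict (cell d)))) ∧
    Summable fun w : Fin d → ℤ =>
      ∫ p, ‖f (p.1, p.2 + latticePt w)‖ ∂(μ.prod (volume.restrict (cell d))) := by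
  have he : ∀ w : Fin d → ℤ,
      MeasurableEmbedding (fun p : X × 𝔼 => (p.1, p.2 + latticePt w)) := fun w =>
    (MeasurableEquiv.prodCongr (MeasurableEquiv.refl X)
      (MeasurableEquiv.addRight (latticePt w))).measurableEmbedding
  rw [prod_volume_eq_sum_map_cell, integrable_sum_measure_iff] at hf
  refine ⟨fun w => ((he w).integrable_map_iff).1 (hf.1 w), ?_⟩
  simpa only [(he _).integral_map] using hf.2

end Unfold

/-- A series of integrable functions with summable `L¹` norms has an integrable sum. -/
lemma integrable_tsum_of_summable_integral_norm {ι X V : Type*} [Countable ι] [MeasurableSpace X]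
    [NormedAddCommGroup V] [CompleteSpace V] {μ : Measure X} {F : ι → X → V}
    (hF : ∀ i, Integrable (F i) μ) (hs : Summable fun i => ∫ x, ‖F i x‖ ∂μ) :
    (∀ᵐ x ∂μ, Summable fun i => F i x) ∧ Integrable (fun x => ∑' i, F i x) μ := by
  have hfin : ∫⁻ x, ∑' i, ‖F i x‖ₑ ∂μ ≠ ⊤ := by
    rw [lintegral_tsum fun i => (hF i).1.enorm]
    convert! hs.tsum_ofReal_ne_top with i
    rw [ofReal_integral_eq_lintegral_ofReal (hF i).norm (ae_of_all _ fun _ => by positivity)]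
    simp_rw [ofReal_norm]
  have hae : ∀ᵐ x ∂μ, Summable fun i => F i x := by
    filter_upwards [ae_lt_top' (AEMeasurable.tsum fun i => (hF i).1.enorm) hfin] with x hx
    have : Summable fun i => ‖F i x‖ := by
      have := ENNReal.summable_toReal hx.ne
      simpa using this
    exact this.of_norm
  refine ⟨hae, ?_, ?_⟩
  · refine aestronglyMeasurable_of_tendsto_ae (u := (atTop : Filter (Finset ι)))
      (f := fun s x => ∑ i ∈ s, F i x) ?_ ?_
    · intro s
      exact Finset.aestronglyMeasurable_fun_sum s fun i _ => (hF i).1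
    · filter_upwards [hae] with x hx
      exact hx.hasSum
  · refine lt_of_le_of_lt (lintegral_mono fun x => ?_) hfin.lt_top
    exact enorm_tsum_le_tsum_enorm

lemma integral_tsum_unfold {V : Type*} [NormedAddCommGroup V] [NormedSpace ℝ V] [CompleteSpace V]
    {f : 𝔼 → V} (hf : Integrable f) :
    ∫ x in cell d, ∑' w : Fin d → ℤ, f (x + latticePt w) = ∫ x, f x := by
  obtain ⟨h1, h2⟩ := unfold_integrable hf
  exact (hasSum_integral_of_summable_integral_norm h1 h2).unique (hasSum_unfold hf)

/-- The integral of a periodic function over the cell is translation invariant. -/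
lemma setIntegral_cell_add {V : Type*} [NormedAddCommGroup V] [NormedSpace ℝ V] [CompleteSpace V]
    {f : 𝔼 → V} (hf : Continuous f) (hp : ∀ x (w : Fin d → ℤ), f (x + latticePt w) = f x)
    (t : 𝔼) :
    ∫ x in cell d, f (x + t) = ∫ x in cell d, f x := by
  have hi : IntegrableOn (fun x => f (x + t)) (cell d) := by
    have hc : Continuous fun x => f (x + t) := by fun_prop
    rw [IntegrableOn, ← integrable_norm_iff hc.aestronglyMeasurable]
    exact integrableOn_cell hc.norm
  -- `g` is `f` restricted to the cell translated by `t`. Every lattice orbit meets that translate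
  -- exactly once, so the periodization of `g` is `f`.
  set g : 𝔼 → V := fun x => (cell d).indicator (fun y => f (y + t)) (x - t) with hg
  have hgi : Integrable g := by
    have := (integrable_indicator_iff measurableSet_cell).2 hi
    exact this.comp_sub_right t
  have h1 : ∫ x, g x = ∫ x in cell d, f (x + t) := by
    rw [hg, integral_sub_right_eq_self (fun x => (cell d).indicator (fun y => f (y + t)) x) t,
      integral_indicator measurableSet_cell]
  rw [← h1, ← integral_tsum_unfold hgi]
  refine setIntegral_congr_fun measurableSet_cell fun x _ => ?_
  have hmem : ∀ w : Fin d → ℤ, x + latticePt w - t ∈ cell d ↔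
      w = -(fun i => ⌊(x - t) i + 1 / 2⌋) := by
    intro w
    have := sub_latticePt_mem_cell (x - t) (-w)
    rw [latticePt_neg, show x - t - -latticePt w = x + latticePt w - t by abel] at this
    rw [this, neg_eq_iff_eq_neg]
  change ∑' w, g (x + latticePt w) = f x
  rw [tsum_eq_single (-(fun i => ⌊(x - t) i + 1 / 2⌋))]
  · rw [hg]
    simp only
    rw [Set.indicator_of_mem ((hmem _).2 rfl), sub_add_cancel, hp]
  · intro w hw
    rw [hg]
    simp only
    rw [Set.indicator_of_notMem fun h => hw ((hmem w).1 h)]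

end Lattice

end TorusBilaplacian

namespace TorusBilaplacian

open Filter Topology

/-! ### Fourier series on the torus: inversion and decay of coefficients -/

section Fourier

variable {d : ℕ}

local notation "𝔼" => EuclideanSpace ℝ (Fin d)

lemma torusChar_add_apply (ν : Fin d → ℤ) (x y : 𝔼) :
    torusChar ν (x + y) = torusChar ν x * torusChar ν y := by
  simp only [torusChar, ← Complex.exp_add, inner_add_right]
  push_cast
  ring_nf

lemma torusChar_add (μ ν : Fin d → ℤ) (x : 𝔼) :
    torusChar (μ + ν) x = torusChar μ x * torusChar ν x := by
  simp only [torusChar, ← Complex.exp_add, latticePt_add, inner_add_left]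
  push_cast
  ring_nf

@[simp] lemma torusChar_zero (x : 𝔼) : torusChar (0 : Fin d → ℤ) x = 1 := by
  simp [torusChar]

@[fun_prop] lemma continuous_torusChar (ν : Fin d → ℤ) : Continuous (torusChar ν) := by
  unfold torusChar
  fun_prop

lemma torusChar_eq_exp_mul_I (ν : Fin d → ℤ) (x : 𝔼) :
    torusChar ν x = Complex.exp ((2 * Real.pi * inner ℝ (latticePt ν) x : ℝ) * Complex.I) := by
  rw [torusChar]
  congr 1
  push_cast
  ring

@[simp] lemma norm_torusChar (ν : Fin d → ℤ) (x : 𝔼) : ‖torusChar ν x‖ = 1 := by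
  rw [torusChar_eq_exp_mul_I, Complex.norm_exp_ofReal_mul_I]

lemma torusChar_neg (ν : Fin d → ℤ) (x : 𝔼) :
    torusChar (-ν) x = (starRingEnd ℂ) (torusChar ν x) := by
  rw [torusChar_eq_exp_mul_I, torusChar_eq_exp_mul_I, ← Complex.exp_conj, latticePt_neg,
    inner_neg_left]
  simp only [map_mul, Complex.conj_ofReal, Complex.conj_I]
  push_cast
  ring_nf

lemma torusChar_apply_neg (ν : Fin d → ℤ) (x : 𝔼) : torusChar ν (-x) = torusChar (-ν) x := by
  simp [torusChar, latticePt_neg, inner_neg_left, inner_neg_right]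

/-- The projection of `ℝ^d` onto the torus of Mathlib. -/
noncomputable def toTorus (x : 𝔼) : UnitAddTorus (Fin d) := fun i => (x i : UnitAddCircle)

lemma isQuotientMap_toTorus : IsQuotientMap (toTorus (d := d)) := by
  have h := IsOpenQuotientMap.piMap (f := fun (_ : Fin d) (t : ℝ) => (t : UnitAddCircle))
    fun _ => QuotientAddGroup.isOpenQuotientMap_mk
  exact h.isQuotientMap.comp (EuclideanSpace.equiv (Fin d) ℝ).toHomeomorph.isQuotientMap

lemma torusChar_eq_mFourier (ν : Fin d → ℤ) (x : 𝔼) :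
    torusChar ν x = UnitAddTorus.mFourier ν (toTorus x) := by
  simp only [UnitAddTorus.mFourier, ContinuousMap.coe_mk, toTorus, fourier_coe_apply,
    ← Complex.exp_sum, torusChar]
  congr 1
  simp only [PiLp.inner_apply, latticePt_apply, Complex.ofReal_sum, Finset.mul_sum]
  refine Finset.sum_congr rfl fun i _ => ?_
  simp
  ring

@[simp] lemma torusChar_latticePt (ν w : Fin d → ℤ) : torusChar ν (latticePt w) = 1 := by
  have : toTorus (latticePt w) = toTorus (0 : 𝔼) := by
    funext i
    have h := QuotientAddGroup.eq_zero_iff (N := AddSubgroup.zmultiples (1 : ℝ)) (w i : ℝ)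
    simp only [toTorus, latticePt_apply]
    refine (h.2 ⟨w i, by simp⟩).trans ?_
    simp
  rw [torusChar_eq_mFourier, this, ← torusChar_eq_mFourier]
  simp [torusChar]

lemma torusChar_periodic (ν w : Fin d → ℤ) (x : 𝔼) :
    torusChar ν (x + latticePt w) = torusChar ν x := by
  rw [torusChar_add_apply, torusChar_latticePt, mul_one]

lemma integrableOn_cell_of_continuous {V : Type*} [NormedAddCommGroup V]
    {f : 𝔼 → V} (hf : Continuous f) : IntegrableOn f (cell d) := by
  rw [IntegrableOn, ← integrable_norm_iff hf.aestronglyMeasurable]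
  exact integrableOn_cell hf.norm

/-- The two half-open cubes differ by a null set; the right-hand one is the domain in
`UnitAddTorus.mFourierCoeff_eq_integral`. -/
lemma setIntegral_cell_eq_Ioc {V : Type*} [NormedAddCommGroup V] [NormedSpace ℝ V]
    (f : (Fin d → ℝ) → V) :
    ∫ x in cell d, f (WithLp.ofLp x) =
      ∫ x in {x : Fin d → ℝ | ∀ i, x i ∈ Set.Ioc (-(1 / 2) : ℝ) (-(1 / 2) + 1)}, f x := by
  have h1 : cell d = WithLp.ofLp ⁻¹' (Set.univ.pi fun _ : Fin d => Set.Ico (-(1 / 2) : ℝ) (1 / 2)) := by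
    ext x; simp [cell]
  rw [h1, (PiLp.volume_preserving_ofLp (Fin d)).setIntegral_preimage_emb
    (MeasurableEquiv.toLp 2 (Fin d → ℝ)).symm.measurableEmbedding]
  refine setIntegral_congr_set ?_
  have h2 : {x : Fin d → ℝ | ∀ i, x i ∈ Set.Ioc (-(1 / 2) : ℝ) (-(1 / 2) + 1)} =
      Set.univ.pi fun _ : Fin d => Set.Ioc (-(1 / 2) : ℝ) (1 / 2) := by
    rw [show (-(1 / 2) : ℝ) + 1 = 1 / 2 by norm_num]
    ext x; simp
  rw [h2]
  exact (Measure.univ_pi_Ico_ae_eq_Icc (μ := fun _ => volume)).trans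
    (Measure.univ_pi_Ioc_ae_eq_Icc (μ := fun _ => volume)).symm

/-- Pointwise Fourier inversion for continuous periodic functions with summable coefficients. -/
lemma hasSum_torusFourier {u : 𝔼 → ℂ} (hu : Continuous u)
    (hp : ∀ x (w : Fin d → ℤ), u (x + latticePt w) = u x) (hs : Summable (torusFourier u)) (x : 𝔼) :
    HasSum (fun ν => torusFourier u ν * torusChar ν x) (u x) := by
  let q : C(𝔼, UnitAddTorus (Fin d)) := ⟨toTorus, isQuotientMap_toTorus.continuous⟩
  have hfac : ∀ x y : 𝔼, q x = q y → (⟨u, hu⟩ : C(𝔼, ℂ)) x = (⟨u, hu⟩ : C(𝔼, ℂ)) y := by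
    intro x y hxy
    have h : ∀ i, ∃ n : ℤ, y i = x i + n := by
      intro i
      have := congrFun hxy i
      obtain ⟨n, hn⟩ := QuotientAddGroup.eq.1 this
      exact ⟨n, by simp at hn; linarith⟩
    choose w hw using h
    have : y = x + latticePt w := by ext i; simp [hw i]
    change u x = u y
    rw [this, hp]
  let F : C(UnitAddTorus (Fin d), ℂ) :=
    Topology.IsQuotientMap.lift (f := q) isQuotientMap_toTorus ⟨u, hu⟩ hfac
  have hF : ∀ x, F (toTorus x) = u x := fun x =>
    congrArg (fun g : C(𝔼, ℂ) => g x)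
      (Topology.IsQuotientMap.lift_comp (f := q) isQuotientMap_toTorus ⟨u, hu⟩ hfac)
  have hc : ∀ ν, UnitAddTorus.mFourierCoeff F ν = torusFourier u ν := by
    intro ν
    rw [UnitAddTorus.mFourierCoeff_eq_integral F ν fun _ => -(1 / 2), torusFourier,
      ← setIntegral_cell_eq_Ioc fun x => UnitAddTorus.mFourier (-ν) (fun i => (x i : UnitAddCircle)) •
        F (fun i => (x i : UnitAddCircle))]
    refine setIntegral_congr_fun measurableSet_cell fun x _ => ?_
    change UnitAddTorus.mFourier (-ν) (toTorus x) • F (toTorus x) = _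
    rw [hF, ← torusChar_eq_mFourier, smul_eq_mul, mul_comm]
  have := UnitAddTorus.hasSum_mFourier_series_apply_of_summable (f := F)
    (by simpa only [funext hc] using hs) (toTorus x)
  simpa only [hF, hc, ← torusChar_eq_mFourier, smul_eq_mul] using this

/-- The integral of `x ↦ f (x + t • v)` over the cell does not depend on `t`; differentiating under
the integral at `t = 0` gives the claim. This is integration by parts without boundary terms. -/
lemma setIntegral_cell_fderiv {f : 𝔼 → ℂ} (hf : ContDiff ℝ 1 f)
    (hp : ∀ x (w : Fin d → ℤ), f (x + latticePt w) = f x) (v : 𝔼) :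
    ∫ x in cell d, fderiv ℝ f x v = 0 := by
  have hd : Continuous fun x => fderiv ℝ f x v :=
    (hf.continuous_fderiv one_ne_zero).clm_apply continuous_const
  have hc : Continuous fun p : ℝ × 𝔼 => fderiv ℝ f (p.2 + p.1 • v) v := by fun_prop
  obtain ⟨M, hM⟩ := ((isCompact_closedBall (0 : ℝ) 1).prod
    (isCompact_closedBall (0 : 𝔼) d)).exists_bound_of_continuousOn
    hc.continuousOn
  have key := hasDerivAt_integral_of_dominated_loc_of_deriv_le (μ := volume.restrict (cell d))
    (F := fun (t : ℝ) (x : 𝔼) => f (x + t • v)) (F' := fun t x => fderiv ℝ f (x + t • v) v)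
    (x₀ := 0) (bound := fun _ => M) (s := Metric.closedBall 0 1)
    (Metric.closedBall_mem_nhds _ one_pos)
    (Eventually.of_forall fun t =>
      (by have := hf.continuous; fun_prop : Continuous fun x => f (x + t • v)).aestronglyMeasurable)
    (integrableOn_cell_of_continuous (by have := hf.continuous; fun_prop))
    (by simpa using hd.aestronglyMeasurable)
    ?_ (integrable_const _) ?_
  · have hconst : (fun t : ℝ => ∫ x in cell d, f (x + t • v)) = fun _ => ∫ x in cell d, f x := by
      funext t
      exact setIntegral_cell_add hf.continuous hp _
    have h2 := key.2
    rw [hconst] at h2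
    simpa using h2.unique (hasDerivAt_const _ _)
  · filter_upwards [ae_restrict_mem measurableSet_cell] with x hx t ht
    exact hM (t, x) ⟨ht, cell_subset_closedBall hx⟩
  · refine Eventually.of_forall fun x t _ => ?_
    have h1 : HasDerivAt (fun t : ℝ => x + t • v) v t := by
      simpa using ((hasDerivAt_id t).smul_const v).const_add x
    exact ((hf.differentiable one_ne_zero _).hasFDerivAt.comp_hasDerivAt t h1)

lemma contDiff_torusChar (ν : Fin d → ℤ) {n : WithTop ℕ∞} : ContDiff ℝ n (torusChar ν) := by
  have h : ContDiff ℝ n fun x : 𝔼 => ((inner ℝ (latticePt ν) x : ℝ) : ℂ) :=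
    Complex.ofRealCLM.contDiff.comp (contDiff_const.inner ℝ contDiff_id)
  unfold torusChar
  exact (contDiff_const.mul h).cexp

lemma fderiv_torusChar (ν : Fin d → ℤ) (x v : 𝔼) :
    fderiv ℝ (torusChar ν) x v =
      2 * Real.pi * Complex.I * (inner ℝ (latticePt ν) v : ℝ) * torusChar ν x := by
  have h : HasFDerivAt (fun x : 𝔼 => ((inner ℝ (latticePt ν) x : ℝ) : ℂ))
      (Complex.ofRealCLM.comp (innerSL ℝ (latticePt ν))) x :=
    Complex.ofRealCLM.hasFDerivAt.comp x (innerSL ℝ (latticePt ν)).hasFDerivAt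
  have h2 := (h.const_mul (2 * Real.pi * Complex.I)).cexp
  have h3 : fderiv ℝ (torusChar ν) x = _ := h2.fderiv
  rw [h3]
  simp [torusChar]
  ring

/-- The Fourier coefficients of a derivative. -/
lemma torusFourier_fderiv {f : 𝔼 → ℂ} (hf : ContDiff ℝ 1 f)
    (hp : ∀ x (w : Fin d → ℤ), f (x + latticePt w) = f x) (v : 𝔼) (ν : Fin d → ℤ) :
    torusFourier (fun x => fderiv ℝ f x v) ν =
      2 * Real.pi * Complex.I * (inner ℝ (latticePt ν) v : ℝ) * torusFourier f ν := by
  have h := setIntegral_cell_fderiv (hf.mul (contDiff_torusChar (-ν)))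
    (fun x w => by simp [hp, torusChar_periodic]) v
  have hd : Continuous fun x => fderiv ℝ f x v :=
    (hf.continuous_fderiv one_ne_zero).clm_apply continuous_const
  have hfc := hf.continuous
  have h1 : ∀ x, fderiv ℝ (fun x => f x * torusChar (-ν) x) x v =
      (fderiv ℝ f x v) * torusChar (-ν) x -
        2 * Real.pi * Complex.I * (inner ℝ (latticePt ν) v : ℝ) * (f x * torusChar (-ν) x) := by
    intro x
    rw [fderiv_fun_mul (hf.differentiable one_ne_zero x)
      ((contDiff_torusChar (-ν)).differentiable (n := 1) one_ne_zero x)]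
    simp only [add_apply, smul_apply, fderiv_torusChar,
      smul_eq_mul, latticePt_neg, inner_neg_left]
    push_cast
    ring
  change ∫ x in cell d, fderiv ℝ (fun x => f x * torusChar (-ν) x) x v = 0 at h
  simp_rw [h1] at h
  rw [integral_sub, integral_const_mul] at h
  · exact sub_eq_zero.1 h
  · exact integrableOn_cell_of_continuous (by fun_prop)
  · exact integrableOn_cell_of_continuous (by fun_prop)

lemma volume_cell : volume (cell d) = 1 := by
  have h1 : cell d = WithLp.ofLp ⁻¹' (Set.univ.pi fun _ : Fin d => Set.Ico (-(1 / 2) : ℝ) (1 / 2)) := by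
    ext x; simp [cell]
  rw [h1, (PiLp.volume_preserving_ofLp (Fin d)).measure_preimage_emb
    (MeasurableEquiv.toLp 2 (Fin d → ℝ)).symm.measurableEmbedding, Real.volume_pi_Ico]
  norm_num

lemma exists_mul_torusFourier_le (i : Fin d) (k : ℕ) : ∀ {f : 𝔼 → ℂ}, ContDiff ℝ ∞ f →
    (∀ x (w : Fin d → ℤ), f (x + latticePt w) = f x) →
    ∃ C, ∀ ν : Fin d → ℤ, |(ν i : ℝ)| ^ k * ‖torusFourier f ν‖ ≤ C := by
  induction k with
  | zero =>
    intro f hf _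
    refine ⟨∫ x in cell d, ‖f x‖, fun ν => ?_⟩
    rw [pow_zero, one_mul, torusFourier]
    refine (norm_integral_le_integral_norm _).trans_eq ?_
    simp
  | succ k ih =>
    intro f hf hp
    have hf1 : ContDiff ℝ 1 f := hf.of_le (by exact_mod_cast le_top)
    obtain ⟨C, hC⟩ := ih (f := fun x => fderiv ℝ f x (EuclideanSpace.single i 1))
      ((hf.fderiv_right (m := ∞) (by simp)).clm_apply contDiff_const) (by
        intro x w
        have : f = fun y => f (y + latticePt w) := funext fun y => (hp y w).symm
        conv_rhs => rw [this]
        rw [fderiv_comp_add_right])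
    refine ⟨C, fun ν => le_trans ?_ (hC ν)⟩
    rw [torusFourier_fderiv hf1 hp]
    have h1 : inner ℝ (latticePt ν) (EuclideanSpace.single i (1 : ℝ)) = (ν i : ℝ) := by
      rw [EuclideanSpace.inner_single_right]; simp
    rw [h1]
    simp only [norm_mul, Complex.norm_real, Real.norm_eq_abs, Complex.norm_I, Complex.norm_ofNat,
      mul_one, pow_succ, abs_of_pos Real.pi_pos]
    -- Each derivative contributes a factor `2π |ν i|`, and `2π ≥ 1` may be dropped.
    have h2 : 0 ≤ |(ν i : ℝ)| ^ k * |(ν i : ℝ)| * ‖torusFourier f ν‖ := by positivity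
    nlinarith [Real.pi_gt_three]

lemma exists_norm_latticePt_pow_mul_torusFourier_le {f : 𝔼 → ℂ} (hf : ContDiff ℝ ∞ f)
    (hp : ∀ x (w : Fin d → ℤ), f (x + latticePt w) = f x) (k : ℕ) :
    ∃ C, ∀ ν : Fin d → ℤ, ‖latticePt ν‖ ^ (k + 1) * ‖torusFourier f ν‖ ≤ C := by
  choose C hC using fun i => exists_mul_torusFourier_le i (k + 1) hf hp
  refine ⟨(d : ℝ) ^ k * ∑ i, C i, fun ν => ?_⟩
  have h1 : ‖latticePt ν‖ ≤ ∑ i, |(ν i : ℝ)| := by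
    rw [EuclideanSpace.norm_eq]
    refine Real.sqrt_le_iff.2 ⟨by positivity, ?_⟩
    simp only [latticePt_apply, Real.norm_eq_abs]
    exact Finset.sum_sq_le_sq_sum_of_nonneg fun i _ => abs_nonneg _
  have h2 : ‖latticePt ν‖ ^ (k + 1) ≤ (d : ℝ) ^ k * ∑ i, |(ν i : ℝ)| ^ (k + 1) := by
    refine (pow_le_pow_left₀ (norm_nonneg _) h1 _).trans ?_
    rcases Nat.eq_zero_or_pos d with rfl | h
    · simp
    · have := pow_sum_div_card_le_sum_pow (s := Finset.univ) (f := fun i => |(ν i : ℝ)|)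
        (fun i _ => abs_nonneg _) k
      rwa [Finset.card_univ, Fintype.card_fin, div_le_iff₀' (by positivity)] at this
  calc _ ≤ ((d : ℝ) ^ k * ∑ i, |(ν i : ℝ)| ^ (k + 1)) * ‖torusFourier f ν‖ := by gcongr
    _ = (d : ℝ) ^ k * ∑ i, |(ν i : ℝ)| ^ (k + 1) * ‖torusFourier f ν‖ := by
      rw [mul_assoc, Finset.sum_mul]
    _ ≤ _ := by gcongr with i _; exact hC i ν

end Fourier

end TorusBilaplacian

namespace TorusBilaplacian

open Filter Topology

/-! ### Periodized kernels as Fourier multipliers, and the second moment -/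

section Kernel

variable {d : ℕ}

local notation "𝔼" => EuclideanSpace ℝ (Fin d)

lemma summable_norm_add_latticePt {n : ℕ} (hn : d < n) (x : 𝔼) :
    Summable fun w : Fin d → ℤ => ‖x + latticePt w‖⁻¹ ^ n := by
  let b := (EuclideanSpace.basisFun (Fin d) ℝ).toBasis
  let L : Submodule ℤ 𝔼 := Submodule.span ℤ (Set.range b)
  have hmem : ∀ w : Fin d → ℤ, latticePt w ∈ L := by
    intro w
    refine (b.mem_span_iff_repr_mem ℤ _).2 fun i => ⟨w i, ?_⟩
    simp [b]
  have hL : Module.finrank ℤ L < n := by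
    have := ZLattice.rank ℝ L
    rwa [this, finrank_euclideanSpace_fin]
  have h := ZLattice.summable_norm_sub_inv_pow L n hL (-x)
  have hinj : Function.Injective fun w : Fin d → ℤ => (⟨latticePt w, hmem w⟩ : L) :=
    fun v w hvw => latticePt_injective (congrArg Subtype.val hvw)
  refine (h.comp_injective hinj).congr fun w => ?_
  simp [add_comm]

lemma summable_norm_torusFourier {f : 𝔼 → ℂ} (hf : ContDiff ℝ ∞ f)
    (hp : ∀ x (w : Fin d → ℤ), f (x + latticePt w) = f x) :
    Summable fun ν => ‖torusFourier f ν‖ := by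
  obtain ⟨C, hC⟩ := exists_norm_latticePt_pow_mul_torusFourier_le hf hp d
  refine Summable.of_norm_bounded_eventually
    ((summable_norm_add_latticePt (Nat.lt_succ_self d) (0 : 𝔼)).mul_left C) ?_
  -- The majorant can fail only at `ν = 0`, where it takes the default value `0⁻¹ = 0`.
  refine (Set.finite_singleton (0 : Fin d → ℤ)).subset fun ν hν => ?_
  by_contra h0
  refine hν ?_
  have h1 : 0 < ‖latticePt ν‖ := one_pos.trans_le (one_le_norm_latticePt h0)
  change ‖‖torusFourier f ν‖‖ ≤ C * ‖0 + latticePt ν‖⁻¹ ^ (d + 1)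
  rw [norm_norm, zero_add, inv_pow, ← div_eq_mul_inv, le_div_iff₀' (by positivity)]
  exact hC ν

lemma norm_eq_norm_sq_mul (z : ℂ) (r : ℝ) :
    (r : ℂ) * (starRingEnd ℂ) z * z = ((r * ‖z‖ ^ 2 : ℝ) : ℂ) := by
  rw [mul_assoc, Complex.conj_mul']
  push_cast
  rfl

/-- The Fourier expansion of the quadratic form of `Δ⁻²`. -/
lemma hasSum_invBilaplacianForm {u : 𝔼 → ℝ} (hu : Continuous u)
    (hs : Summable fun ν => ‖torusFourier (fun x => (u x : ℂ)) ν‖) :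
    HasSum (fun ν : {ν : Fin d → ℤ // ν ≠ 0} => ((‖latticePt ν.1‖ ^ (2 * (-2) : ℝ) *
      ‖torusFourier (fun x => (u x : ℂ)) ν.1‖ ^ 2 : ℝ) : ℂ)) (invBilaplacianForm u) := by
  set U : 𝔼 → ℂ := fun x => (u x : ℂ) with hU
  have hUc : Continuous U := by fun_prop
  have hi : ∀ ν : {ν : Fin d → ℤ // ν ≠ 0}, Integrable (fun x => U x * (starRingEnd ℂ)
      (((‖latticePt ν.1‖ ^ (2 * (-2) : ℝ) : ℝ) : ℂ) * torusFourier U ν.1 * torusChar ν.1 x))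
      (volume.restrict (cell d)) := fun ν =>
    integrableOn_cell_of_continuous (by
      have := continuous_torusChar ν.1
      exact hUc.mul (Complex.continuous_conj.comp (by fun_prop)))
  have h := hasSum_integral_of_summable_integral_norm hi ?_
  · unfold invBilaplacianForm torusInner invBilaplacian negLaplacianPow
    simp_rw [tsum_mul_left, ← Complex.conj_tsum] at h
    convert! h using 1
    funext ν
    have : ∀ x, U x * (starRingEnd ℂ)
        (((‖latticePt ν.1‖ ^ (2 * (-2) : ℝ) : ℝ) : ℂ) * torusFourier U ν.1 * torusChar ν.1 x) =
        ((‖latticePt ν.1‖ ^ (2 * (-2) : ℝ) : ℝ) : ℂ) * (starRingEnd ℂ) (torusFourier U ν.1) *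
          (U x * torusChar (-ν.1) x) := by
      intro x
      rw [map_mul, map_mul, Complex.conj_ofReal, torusChar_neg]
      ring
    simp_rw [this]
    rw [integral_const_mul, ← norm_eq_norm_sq_mul]
    rfl
  · simp only [norm_mul, RCLike.norm_conj, norm_torusChar, mul_one]
    simp_rw [integral_mul_const]
    refine Summable.mul_left _ (Summable.of_nonneg_of_le (fun ν => by positivity) (fun ν => ?_)
      (hs.comp_injective Subtype.val_injective))
    have h1 : ‖latticePt ν.1‖ ^ (2 * (-2) : ℝ) ≤ 1 :=
      Real.rpow_le_one_of_one_le_of_nonpos (one_le_norm_latticePt ν.2) (by norm_num)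
    rw [Complex.norm_real, Real.norm_of_nonneg (by positivity)]
    exact mul_le_of_le_one_left (norm_nonneg _) h1

/-- The Fourier transform of an integrable function at a lattice point. -/
noncomputable def latticeFourier (g : 𝔼 → ℝ) (ν : Fin d → ℤ) : ℂ :=
  ∫ y, (g y : ℂ) * torusChar (-ν) y

/-- The Fourier series of `u (x - y)` is inserted into `∫ G y * u (x - y)` and integrated termwise,
which absolute summability of the coefficients permits. -/
lemma hasSum_convolution {u G : 𝔼 → ℝ} (hu : Continuous u)
    (hp : ∀ x (w : Fin d → ℤ), u (x + latticePt w) = u x)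
    (hs : Summable fun ν => ‖torusFourier (fun x => (u x : ℂ)) ν‖)
    (hG : Integrable G) (x : 𝔼) :
    HasSum (fun ν => torusFourier (fun x => (u x : ℂ)) ν * torusChar ν x * latticeFourier G ν)
      ((∫ y, u y * G (x - y) : ℝ) : ℂ) := by
  set U : 𝔼 → ℂ := fun x => (u x : ℂ) with hU
  have hUc : Continuous U := by fun_prop
  have hi : ∀ ν : Fin d → ℤ, Integrable fun y =>
      (torusFourier U ν * torusChar ν x) * ((G y : ℂ) * torusChar (-ν) y) := fun ν =>
    (hG.ofReal.mul_bdd (c := 1) (continuous_torusChar (-ν)).aestronglyMeasurable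
      (Eventually.of_forall fun y => by simp)).const_mul _
  have h := hasSum_integral_of_summable_integral_norm hi ?_
  · simp_rw [integral_const_mul] at h
    convert! h using 1
    rw [← integral_sub_left_eq_self (fun y => u y * G (x - y)) volume x, ← integral_complex_ofReal]
    refine integral_congr_ae (Eventually.of_forall fun y => ?_)
    have h2 := (hasSum_torusFourier hUc (fun x w => by simp [U, hp]) hs.of_norm (x - y)).mul_left
      (G y : ℂ)
    simp only [sub_sub_cancel]
    push_cast
    rw [mul_comm]
    refine (h2.tsum_eq.symm.trans (tsum_congr fun ν => ?_))
    rw [sub_eq_add_neg, torusChar_add_apply, torusChar_apply_neg]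
    ring
  · simp only [norm_mul, norm_torusChar, mul_one]
    simp_rw [integral_const_mul]
    exact hs.mul_right _

lemma exists_bound_of_summable_torusFourier {u : 𝔼 → ℝ} (hu : Continuous u)
    (hp : ∀ x (w : Fin d → ℤ), u (x + latticePt w) = u x)
    (hs : Summable fun ν => ‖torusFourier (fun x => (u x : ℂ)) ν‖) : ∃ M, ∀ x, ‖u x‖ ≤ M := by
  refine ⟨∑' ν, ‖torusFourier (fun x => (u x : ℂ)) ν‖, fun x => ?_⟩
  have h := (hasSum_torusFourier (u := fun x => (u x : ℂ)) (by fun_prop)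
    (fun x w => by simp [hp]) hs.of_norm x).tsum_eq
  rw [← Complex.norm_real, ← h]
  refine (norm_tsum_le_tsum_norm (by simpa using hs)).trans_eq ?_
  simp

/-- The integral operator with the periodization of `G` as its kernel is the Fourier multiplier
with the symbol `latticeFourier G`. -/
lemma periodization_form {u G : 𝔼 → ℝ} (hu : Continuous u)
    (hp : ∀ x (w : Fin d → ℤ), u (x + latticePt w) = u x)
    (hs : Summable fun ν => ‖torusFourier (fun x => (u x : ℂ)) ν‖)
    (hG : Integrable G) :
    IntegrableOn (fun p : 𝔼 × 𝔼 => u p.1 * u p.2 *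
        ∑' w : Fin d → ℤ, G (p.1 - p.2 + latticePt w)) (cell d ×ˢ cell d) ∧
      HasSum (fun ν => latticeFourier G ν * ((‖torusFourier (fun x => (u x : ℂ)) ν‖ ^ 2 : ℝ) : ℂ))
        ((∫ p in cell d ×ˢ cell d, u p.1 * u p.2 *
          ∑' w : Fin d → ℤ, G (p.1 - p.2 + latticePt w) : ℝ) : ℂ) := by
  obtain ⟨M, hM⟩ := exists_bound_of_summable_torusFourier hu hp hs
  set H : 𝔼 × 𝔼 → ℝ := fun p => u p.1 * u p.2 * G (p.1 - p.2) with hH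
  have hprod : (volume : Measure (𝔼 × 𝔼)).restrict (cell d ×ˢ cell d) =
      (volume.restrict (cell d)).prod (volume.restrict (cell d)) :=
    (Measure.prod_restrict _ _).symm
  have hkernel : (fun p : 𝔼 × 𝔼 => u p.1 * u p.2 *
      ∑' w : Fin d → ℤ, G (p.1 - p.2 + latticePt w)) =
      fun p => ∑' w : Fin d → ℤ, H (p.1, p.2 + latticePt w) := by
    funext p
    -- After `w ↦ -w` the lattice shift of the kernel becomes a shift of the second variable, which
    -- the factor `u p.2` absorbs by periodicity.
    rw [← (Equiv.neg (Fin d → ℤ)).tsum_eq, ← tsum_mul_left]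
    refine tsum_congr fun w => ?_
    simp only [hH, Equiv.neg_apply, latticePt_neg, hp, sub_add_eq_sub_sub, ← sub_eq_add_neg]
  have hHint : Integrable H ((volume.restrict (cell d)).prod volume) := by
    have h1 : Integrable (fun p : 𝔼 × 𝔼 => G p.2) ((volume.restrict (cell d)).prod volume) :=
      hG.comp_snd _
    -- This shear carries the integrable function `G p.2` to `G (p.1 - p.2)`.
    have h2 : MeasurePreserving (fun p : 𝔼 × 𝔼 => (p.1, p.1 - p.2))
        ((volume.restrict (cell d)).prod volume) ((volume.restrict (cell d)).prod volume) :=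
      (MeasurePreserving.id _).skew_product (g := fun x y => x - y) (by fun_prop)
        (Eventually.of_forall fun x => (Measure.measurePreserving_sub_left volume x).map_eq)
    have h3 := h2.integrable_comp_of_integrable h1
    refine h3.bdd_mul (c := M * M) (by fun_prop) (Eventually.of_forall fun p => ?_)
    rw [norm_mul]
    exact mul_le_mul (hM _) (hM _) (norm_nonneg _) ((norm_nonneg _).trans (hM p.1))
  obtain ⟨h1, h2⟩ := unfold_prod_integrable hHint
  have hint := (integrable_tsum_of_summable_integral_norm h1 h2).2
  rw [IntegrableOn, hprod, hkernel]
  refine ⟨hint, ?_⟩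
  rw [integral_prod _ hint]
  have hinner : ∀ x, ∫ y in cell d, ∑' w : Fin d → ℤ, H (x, y + latticePt w) =
      u x * ∫ y, u y * G (x - y) := by
    intro x
    have hx : Integrable fun y => H (x, y) := by
      refine (hG.comp_sub_left x).bdd_mul (c := M * M) (by fun_prop)
        (Eventually.of_forall fun y => ?_)
      rw [norm_mul]
      exact mul_le_mul (hM _) (hM _) (norm_nonneg _) ((norm_nonneg _).trans (hM x))
    rw [integral_tsum_unfold hx, ← integral_const_mul]
    simp only [hH, mul_assoc]
  simp_rw [hinner]
  rw [← integral_complex_ofReal]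
  set U : 𝔼 → ℂ := fun x => (u x : ℂ) with hU
  have hUc : Continuous U := by fun_prop
  have hi : ∀ ν : Fin d → ℤ, Integrable (fun x => (torusFourier U ν * latticeFourier G ν) *
      (U x * torusChar ν x)) (volume.restrict (cell d)) := fun ν =>
    integrableOn_cell_of_continuous (by fun_prop)
  have hbd : ∀ ν, ‖latticeFourier G ν‖ ≤ ∫ y, ‖G y‖ := by
    intro ν
    refine (norm_integral_le_integral_norm _).trans_eq ?_
    simp
  have h := hasSum_integral_of_summable_integral_norm hi ?_
  · convert! h using 1
    · funext ν
      rw [integral_const_mul]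
      have : ∫ x in cell d, U x * torusChar ν x = (starRingEnd ℂ) (torusFourier U ν) := by
        rw [torusFourier, ← integral_conj]
        refine integral_congr_ae (Eventually.of_forall fun x => ?_)
        simp [U, torusChar_neg]
      rw [this, mul_comm (torusFourier U ν), mul_assoc, Complex.mul_conj']
      push_cast
      rfl
    · refine integral_congr_ae (Eventually.of_forall fun x => ?_)
      have h3 := ((hasSum_convolution hu hp hs hG x).mul_left (U x)).tsum_eq
      refine (Complex.ofReal_mul _ _).trans (h3.symm.trans (tsum_congr fun ν => ?_))
      ring
  · simp only [norm_mul, norm_torusChar, mul_one]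
    simp_rw [integral_const_mul]
    refine Summable.mul_right _ (Summable.of_nonneg_of_le (fun ν => by positivity) (fun ν => ?_)
      (hs.mul_right (∫ y, ‖G y‖)))
    exact mul_le_mul_of_nonneg_left (hbd ν) (norm_nonneg _)

/-- If the Fourier transform of `G` at the nonzero lattice points is `‖ν‖⁻⁴`, the periodization of
`G` is a kernel of `Δ⁻²` on functions with zero average. -/
lemma invBilaplacianForm_eq_periodization {G : 𝔼 → ℝ} (hG : Integrable G)
    (hfourier : ∀ ν : Fin d → ℤ, ν ≠ 0 →
      latticeFourier G ν = ((‖latticePt ν‖ ^ (2 * (-2) : ℝ) : ℝ) : ℂ)) (u : ZeroAvgSmooth d) :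
    IntegrableOn (fun p : 𝔼 × 𝔼 => u.1 p.1 * u.1 p.2 *
        ∑' w : Fin d → ℤ, G (p.1 - p.2 + latticePt w)) (cell d ×ˢ cell d) ∧
      invBilaplacianForm u.1 = ((∫ p in cell d ×ˢ cell d, u.1 p.1 * u.1 p.2 *
          ∑' w : Fin d → ℤ, G (p.1 - p.2 + latticePt w) : ℝ) : ℂ) := by
  obtain ⟨u, hu, hp, h0⟩ := u
  have hs : Summable fun ν => ‖torusFourier (fun x => (u x : ℂ)) ν‖ :=
    summable_norm_torusFourier (Complex.ofRealCLM.contDiff.comp hu) fun x w => by simp [hp]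
  obtain ⟨h1, h2⟩ := periodization_form hu.continuous hp hs hG
  refine ⟨h1, (hasSum_invBilaplacianForm hu.continuous hs).unique ?_⟩
  -- The zero average removes the term `ν = 0`, so the value `latticeFourier G 0` plays no role.
  have hz : torusFourier (fun x => (u x : ℂ)) 0 = 0 := by
    simp only [torusFourier, neg_zero, torusChar_zero, mul_one]
    rw [integral_complex_ofReal, h0]
    simp
  have h3 := (hasSum_subtype_iff_of_support_subset (s := {ν : Fin d → ℤ | ν ≠ 0}) ?_).2 h2
  · convert! h3 using 1
    funext ν
    simp only [Function.comp_apply]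
    rw [hfourier ν.1 ν.2]
    push_cast
    rfl
  · intro ν hν h
    subst h
    simp [hz] at hν

/-- The Fourier expansion has nonnegative terms. Hence neither `.re` nor `toNNReal` in the
definition of the field loses information. -/
lemma invBilaplacianForm_eq_re (u : ZeroAvgSmooth d) :
    0 ≤ (invBilaplacianForm u.1).re ∧
      (((invBilaplacianForm u.1).re : ℝ) : ℂ) = invBilaplacianForm u.1 := by
  obtain ⟨u, hu, hp, h0⟩ := u
  have hs : Summable fun ν => ‖torusFourier (fun x => (u x : ℂ)) ν‖ :=
    summable_norm_torusFourier (Complex.ofRealCLM.contDiff.comp hu) fun x w => by simp [hp]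
  have h := hasSum_invBilaplacianForm hu.continuous hs
  have hre := Complex.hasSum_re h
  simp only [Complex.ofReal_re] at hre
  refine ⟨hre.nonneg fun ν => by positivity, ?_⟩
  exact (Complex.hasSum_ofReal.2 hre).unique h

/-- The second moment of a bilaplacian field. -/
lemma IsBilaplacianField.integral_sq {Ω : Type*} [MeasurableSpace Ω] {P : Measure Ω}
    {Ξ : ZeroAvgSmooth d → Ω → ℝ} (h : IsBilaplacianField P Ξ) (u : ZeroAvgSmooth d) :
    Integrable (fun o => Ξ u o ^ 2) P ∧
      ((∫ o, Ξ u o ^ 2 ∂P : ℝ) : ℂ) = invBilaplacianForm u.1 := by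
  have hl := h.hasLaw u
  obtain ⟨hnn, hre⟩ := invBilaplacianForm_eq_re u
  set v := (invBilaplacianForm u.1).re.toNNReal with hv
  have hi : Integrable (fun x : ℝ => x ^ 2) (gaussianReal 0 v) :=
    (memLp_id_gaussianReal (μ := 0) (v := v) 2).integrable_sq
  have hint : ∫ x, x ^ 2 ∂gaussianReal 0 v = v := by
    have := variance_id_gaussianReal (μ := 0) (v := v)
    rw [variance_of_integral_eq_zero (by fun_prop) (by simp)] at this
    simpa using this
  constructor
  · have := hl.map_eq ▸ hi
    exact (integrable_map_measure (by fun_prop) hl.aemeasurable).1 this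
  · have : ∫ o, Ξ u o ^ 2 ∂P = v := by
      rw [← hint, ← hl.map_eq, integral_map hl.aemeasurable (by fun_prop)]
    rw [this, ← hre, hv, Real.coe_toNNReal _ hnn]

end Kernel

end TorusBilaplacian

namespace TorusBilaplacian

open Filter Topology

/-! ### Short heat times: incomplete Gamma integrals and Gaussians -/

section ShortRange

variable {d : ℕ}

local notation "𝔼" => EuclideanSpace ℝ (Fin d)

/-- The truncated Gamma integral `∫_0^1 t^{a-1} exp(-π² y t) dt`. -/
noncomputable def lowerGamma (a y : ℝ) : ℝ :=
  ∫ t in Set.Ioc (0 : ℝ) 1, t ^ (a - 1) * Real.exp (-(Real.pi ^ 2 * y) * t)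

/-- The truncated Gamma integral `∫_1^∞ t^{a-1} exp(-π² y t) dt`. -/
noncomputable def upperGamma (a y : ℝ) : ℝ :=
  ∫ t in Set.Ioi (1 : ℝ), t ^ (a - 1) * Real.exp (-(Real.pi ^ 2 * y) * t)

lemma integrableOn_Ioc_rpow {a : ℝ} (ha : 0 < a) :
    IntegrableOn (fun t : ℝ => t ^ (a - 1)) (Set.Ioc 0 1) :=
  (intervalIntegrable_iff_integrableOn_Ioc_of_le zero_le_one).1
    (intervalIntegral.intervalIntegrable_rpow' (by linarith))

lemma integrableOn_lowerGamma {a : ℝ} (ha : 0 < a) (y : ℝ) :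
    IntegrableOn (fun t : ℝ => t ^ (a - 1) * Real.exp (-(Real.pi ^ 2 * y) * t)) (Set.Ioc 0 1) := by
  refine (integrableOn_Ioc_rpow ha).mul_bdd (c := Real.exp (Real.pi ^ 2 * |y|)) (by fun_prop) ?_
  filter_upwards [ae_restrict_mem measurableSet_Ioc] with t ht
  rw [Real.norm_eq_abs, Real.abs_exp, Real.exp_le_exp]
  have h1 : -y * t ≤ |y| * 1 := by
    calc -y * t ≤ |y| * t := by gcongr; exacts [ht.1.le, neg_le_abs y]
      _ ≤ _ := by gcongr; exact ht.2
  nlinarith [sq_nonneg Real.pi]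

/-- Since `t` stays in `(0, 1]`, differentiation under the integral works at every real `y`,
including `y = 0`. The derivative has the same form with `a + 1`, so smoothness follows by
induction. -/
lemma hasDerivAt_lowerGamma {a : ℝ} (ha : 0 < a) (y : ℝ) :
    HasDerivAt (lowerGamma a) (-Real.pi ^ 2 * lowerGamma (a + 1) y) y := by
  have h := hasDerivAt_integral_of_dominated_loc_of_deriv_le
    (μ := volume.restrict (Set.Ioc (0 : ℝ) 1))
    (F := fun y t => t ^ (a - 1) * Real.exp (-(Real.pi ^ 2 * y) * t))
    (F' := fun y t => -Real.pi ^ 2 * (t ^ (a + 1 - 1) * Real.exp (-(Real.pi ^ 2 * y) * t)))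
    (x₀ := y) (s := Metric.ball y 1)
    (bound := fun t => Real.pi ^ 2 * (t ^ (a + 1 - 1) *
      Real.exp (-(Real.pi ^ 2 * (-(|y| + 1))) * t)))
    (Metric.ball_mem_nhds _ one_pos)
    (Eventually.of_forall fun z => (integrableOn_lowerGamma ha z).aestronglyMeasurable)
    (integrableOn_lowerGamma ha y)
    ((integrableOn_lowerGamma (by linarith) y).aestronglyMeasurable.const_mul _) ?_
    ((integrableOn_lowerGamma (by linarith) _).const_mul _) ?_
  · have := h.2
    rw [integral_const_mul] at this
    exact this
  · filter_upwards [ae_restrict_mem measurableSet_Ioc] with t ht z hz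
    have h0 := ht.1.le
    rw [norm_mul, norm_neg, norm_mul, Real.norm_of_nonneg (by positivity),
      Real.norm_of_nonneg (by positivity), Real.norm_of_nonneg (by positivity)]
    have hz1 : -(|y| + 1) ≤ z := by
      have := abs_lt.1 (Metric.mem_ball.1 hz)
      have := neg_abs_le y
      linarith
    gcongr
  · filter_upwards [ae_restrict_mem measurableSet_Ioc] with t ht z _
    have h1 : HasDerivAt (fun z : ℝ => -(Real.pi ^ 2 * z) * t) (-Real.pi ^ 2 * t) z := by
      have := (((hasDerivAt_id z).const_mul (Real.pi ^ 2)).neg).mul_const t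
      simpa using this
    have h2 := h1.exp.const_mul (t ^ (a - 1))
    refine h2.congr_deriv ?_
    rw [show a + 1 - 1 = (a - 1) + 1 by ring, Real.rpow_add_one ht.1.ne']
    ring

lemma contDiff_lowerGamma {a : ℝ} (ha : 0 < a) : ContDiff ℝ ∞ (lowerGamma a) := by
  rw [contDiff_infty]
  intro n
  induction n generalizing a with
  | zero =>
    exact contDiff_zero.2 (continuous_iff_continuousAt.2 fun y =>
      (hasDerivAt_lowerGamma ha y).continuousAt)
  | succ n ih =>
    rw [show ((n + 1 : ℕ) : WithTop ℕ∞) = (n : WithTop ℕ∞) + 1 by push_cast; rfl,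
      contDiff_succ_iff_deriv]
    refine ⟨fun y => (hasDerivAt_lowerGamma ha y).differentiableAt, by simp, ?_⟩
    rw [funext fun y => (hasDerivAt_lowerGamma ha y).deriv]
    exact contDiff_const.mul (ih (by linarith))

lemma integrableOn_Ioi_gamma {a y : ℝ} (ha : 0 < a) (hy : 0 < y) :
    IntegrableOn (fun t : ℝ => t ^ (a - 1) * Real.exp (-(Real.pi ^ 2 * y) * t)) (Set.Ioi 0) := by
  have hb : 0 < Real.pi ^ 2 * y := by positivity
  have := integrableOn_rpow_mul_exp_neg_mul_rpow (p := 1) (s := a - 1) (b := Real.pi ^ 2 * y)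
    (by linarith) one_pos hb
  simpa using this

lemma lowerGamma_add_upperGamma {a y : ℝ} (ha : 0 < a) (hy : 0 < y) :
    lowerGamma a y + upperGamma a y = (1 / (Real.pi ^ 2 * y)) ^ a * Real.Gamma a := by
  have hi := integrableOn_Ioi_gamma ha hy
  rw [lowerGamma, upperGamma, ← setIntegral_union (Set.Ioc_disjoint_Ioi le_rfl) measurableSet_Ioi
    (hi.mono_set Set.Ioc_subset_Ioi_self) (hi.mono_set (Set.Ioi_subset_Ioi zero_le_one)),
    Set.Ioc_union_Ioi_eq_Ioi zero_le_one,
    ← Real.integral_rpow_mul_exp_neg_mul_Ioi ha (by positivity : 0 < Real.pi ^ 2 * y)]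
  simp only [neg_mul]

lemma upperGamma_nonneg (a y : ℝ) : 0 ≤ upperGamma a y :=
  setIntegral_nonneg measurableSet_Ioi fun t ht => by
    have : (0 : ℝ) < t := one_pos.trans ht
    positivity

/-- From `exp s ≥ s ^ k / k!` with `s = π² y t`; the condition `a < k` makes the remaining power of
`t` integrable at infinity. -/
lemma exists_upperGamma_le (a : ℝ) (k : ℕ) (hk : a < k) :
    ∃ C, ∀ y, 0 < y → upperGamma a y ≤ C * y⁻¹ ^ k := by
  have hint : IntegrableOn (fun t : ℝ => t ^ (a - 1 - k)) (Set.Ioi 1) :=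
    integrableOn_Ioi_rpow_of_lt (by linarith) one_pos
  refine ⟨k.factorial * (Real.pi ^ 2)⁻¹ ^ k * ∫ t in Set.Ioi (1 : ℝ), t ^ (a - 1 - k),
    fun y hy => ?_⟩
  have h1 : ∀ t ∈ Set.Ioi (1 : ℝ), t ^ (a - 1) * Real.exp (-(Real.pi ^ 2 * y) * t) ≤
      k.factorial * (Real.pi ^ 2)⁻¹ ^ k * y⁻¹ ^ k * t ^ (a - 1 - k) := by
    intro t ht
    have ht0 : (0 : ℝ) < t := one_pos.trans ht
    have h2 := Real.pow_div_factorial_le_exp (x := Real.pi ^ 2 * y * t) (by positivity) k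
    rw [neg_mul, Real.exp_neg, Real.rpow_sub ht0 (a - 1), Real.rpow_natCast]
    have h3 : (Real.exp (Real.pi ^ 2 * y * t))⁻¹ ≤
        ((Real.pi ^ 2 * y * t) ^ k / k.factorial)⁻¹ := by
      have : 0 < (Real.pi ^ 2 * y * t) ^ k / k.factorial := by positivity
      gcongr
    calc _ ≤ t ^ (a - 1) * ((Real.pi ^ 2 * y * t) ^ k / k.factorial)⁻¹ := by gcongr
      _ = _ := by
        rw [mul_pow, mul_pow, inv_pow, inv_pow]
        field_simp
  have hr : IntegrableOn (fun t : ℝ => k.factorial * (Real.pi ^ 2)⁻¹ ^ k * y⁻¹ ^ k *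
      t ^ (a - 1 - k)) (Set.Ioi 1) := hint.const_mul _
  refine (integral_mono_of_nonneg ?_ hr ?_).trans_eq ?_
  · filter_upwards [ae_restrict_mem measurableSet_Ioi] with t ht
    have : (0 : ℝ) < t := one_pos.trans ht
    simp only [Pi.zero_apply]
    positivity
  · filter_upwards [ae_restrict_mem measurableSet_Ioi] with t ht using h1 t ht
  · rw [integral_const_mul]
    ring

/-- The part of the kernel of `Δ⁻²` contributed by heat times less than `1`. -/
noncomputable def shortKernel (x : 𝔼) : ℝ :=
  Real.pi ^ ((d : ℝ) / 2) * upperGamma (((d : ℝ) - 4) / 2) (‖x‖ ^ 2)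

lemma summable_shortKernel {x : 𝔼} (hx : ∀ w : Fin d → ℤ, x ≠ latticePt w) :
    Summable fun w : Fin d → ℤ => shortKernel (x + latticePt w) := by
  obtain ⟨C, hC⟩ := exists_upperGamma_le (((d : ℝ) - 4) / 2) (d + 1) (by
    have : (0 : ℝ) ≤ d := by positivity
    push_cast
    linarith)
  have hs := summable_norm_add_latticePt (n := 2 * (d + 1)) (by lia) x
  refine Summable.mul_left _ (Summable.of_nonneg_of_le (fun w => upperGamma_nonneg _ _)
    (fun w => ?_) (hs.mul_left C))
  have h0 : x + latticePt w ≠ 0 := fun h => hx (-w) (by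
    rw [latticePt_neg]; exact eq_neg_of_add_eq_zero_left h)
  have h1 : 0 < ‖x + latticePt w‖ := norm_pos_iff.2 h0
  refine (hC _ (by positivity)).trans_eq ?_
  rw [pow_mul, inv_pow, inv_pow, inv_pow]

lemma integral_gaussian_mul_torusChar {t : ℝ} (ht : 0 < t) (ν : Fin d → ℤ) :
    ∫ x : 𝔼, (Real.exp (-(Real.pi ^ 2 * ‖x‖ ^ 2) * t) : ℂ) * torusChar ν x =
      (((Real.pi * t)⁻¹ ^ ((d : ℝ) / 2) * Real.exp (-(‖latticePt ν‖ ^ 2 / t)) : ℝ) : ℂ) := by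
  have hb : 0 < ((Real.pi ^ 2 * t : ℝ) : ℂ).re := by
    rw [Complex.ofReal_re]; positivity
  have h := GaussianFourier.integral_cexp_neg_mul_sq_norm_add hb (2 * Real.pi * Complex.I)
    (latticePt ν)
  have ht' : (t : ℂ) ≠ 0 := by exact_mod_cast ht.ne'
  have hpi : (Real.pi : ℂ) ≠ 0 := by exact_mod_cast Real.pi_ne_zero
  convert! h using 1
  · refine integral_congr_ae (Eventually.of_forall fun x => ?_)
    simp only [torusChar, Complex.ofReal_exp, ← Complex.exp_add]
    congr 1
    push_cast
    ring
  · rw [finrank_euclideanSpace_fin, Complex.ofReal_mul, Complex.ofReal_cpow (by positivity),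
      Complex.ofReal_exp]
    congr 2
    · push_cast
      field_simp
    · push_cast
      rfl
    · push_cast
      field_simp
      rw [Complex.I_sq]
      ring

lemma integral_gaussian {t : ℝ} (ht : 0 < t) :
    ∫ x : 𝔼, Real.exp (-(Real.pi ^ 2 * ‖x‖ ^ 2) * t) = (Real.pi * t)⁻¹ ^ ((d : ℝ) / 2) := by
  have h := integral_gaussian_mul_torusChar (d := d) ht 0
  simp only [torusChar_zero, mul_one] at h
  rw [integral_complex_ofReal] at h
  simpa using Complex.ofReal_injective h

/-- A non-integrable function would have integral `0` by convention, but the computed value is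
positive. -/
lemma integrable_gaussian {t : ℝ} (ht : 0 < t) :
    Integrable fun x : 𝔼 => Real.exp (-(Real.pi ^ 2 * ‖x‖ ^ 2) * t) := by
  by_contra h
  have h1 := integral_undef h
  rw [integral_gaussian ht] at h1
  have : 0 < (Real.pi * t)⁻¹ ^ ((d : ℝ) / 2) := by positivity
  exact this.ne' h1

/-- The Gaussian mass cancels the dimension in the exponent. What remains is `t⁻³ dt`, that is, `s
ds` in the heat time `s = 1/t`; its integrability on `(1, ∞)` also puts `shortKernel` in `L¹`. -/
lemma rpow_mul_inv_rpow {t : ℝ} (ht : 0 < t) :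
    t ^ (((d : ℝ) - 4) / 2 - 1) * (Real.pi * t)⁻¹ ^ ((d : ℝ) / 2) =
      (Real.pi ^ ((d : ℝ) / 2))⁻¹ * t ^ (-3 : ℝ) := by
  rw [Real.inv_rpow (by positivity), Real.mul_rpow Real.pi_pos.le ht.le, mul_inv,
    ← Real.rpow_neg ht.le, mul_left_comm, ← Real.rpow_add ht]
  congr 2
  ring

lemma integrable_shortKernel_prod :
    Integrable (fun p : ℝ × 𝔼 => p.1 ^ (((d : ℝ) - 4) / 2 - 1) *
      Real.exp (-(Real.pi ^ 2 * ‖p.2‖ ^ 2) * p.1))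
      ((volume.restrict (Set.Ioi (1 : ℝ))).prod volume) := by
  rw [integrable_prod_iff (by fun_prop)]
  constructor
  · filter_upwards [ae_restrict_mem measurableSet_Ioi] with t ht
    exact (integrable_gaussian (one_pos.trans ht)).const_mul _
  · have h3 : IntegrableOn (fun t : ℝ => (Real.pi ^ ((d : ℝ) / 2))⁻¹ * t ^ (-3 : ℝ))
        (Set.Ioi 1) := (integrableOn_Ioi_rpow_of_lt (by norm_num) one_pos).const_mul _
    refine h3.congr ?_
    filter_upwards [ae_restrict_mem measurableSet_Ioi] with t ht
    have ht0 : (0 : ℝ) < t := one_pos.trans ht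
    rw [← rpow_mul_inv_rpow ht0, ← integral_gaussian ht0, ← integral_const_mul]
    refine integral_congr_ae (Eventually.of_forall fun x => ?_)
    simp only
    rw [Real.norm_of_nonneg (by positivity)]

lemma integrable_shortKernel : Integrable (shortKernel (d := d)) :=
  (integrable_shortKernel_prod.integral_prod_right).const_mul _

/-- The Fourier transform of the part of `‖ν‖⁻⁴` contributed by heat times at least `1`, as a
function of `N = ‖ν‖²`. -/
noncomputable def heatTail (N : ℝ) : ℝ := Real.exp (-N) * (1 / N + 1 / N ^ 2)

/-- The integrand has the antiderivative `exp(-N/t) (1/(Nt) + 1/N²)`, which tends to `1/N²` at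
infinity and equals `heatTail N` at `t = 1`. -/
lemma integral_rpow_mul_exp_neg_div {N : ℝ} (hN : 0 < N) :
    ∫ t in Set.Ioi (1 : ℝ), t ^ (-3 : ℝ) * Real.exp (-(N / t)) = 1 / N ^ 2 - heatTail N := by
  have hd : ∀ t ∈ Set.Ici (1 : ℝ), HasDerivAt
      (fun t : ℝ => Real.exp (-(N / t)) * (1 / (N * t) + 1 / N ^ 2))
      (t ^ (-3 : ℝ) * Real.exp (-(N / t))) t := by
    intro t ht
    have ht0 : (0 : ℝ) < t := one_pos.trans_le ht
    have h1 : HasDerivAt (fun t : ℝ => -(N / t)) (N / t ^ 2) t := by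
      have := ((hasDerivAt_inv ht0.ne').const_mul N).neg
      refine (this.congr_deriv ?_)
      field_simp
    have h2 : HasDerivAt (fun t : ℝ => 1 / (N * t) + 1 / N ^ 2) (-(1 / (N * t ^ 2))) t := by
      have := ((hasDerivAt_inv ht0.ne').const_mul N⁻¹).add_const (1 / N ^ 2)
      refine (this.congr_deriv ?_).congr_of_eventuallyEq (Eventually.of_forall fun s => ?_)
      · field_simp
      · simp [mul_comm]
    refine (h1.exp.mul h2).congr_deriv ?_
    rw [Real.rpow_neg ht0.le, show (3 : ℝ) = ((3 : ℕ) : ℝ) by norm_num, Real.rpow_natCast]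
    field_simp
    ring
  have ht : Tendsto (fun t : ℝ => Real.exp (-(N / t)) * (1 / (N * t) + 1 / N ^ 2)) atTop
      (𝓝 (1 / N ^ 2)) := by
    have h1 : Tendsto (fun t : ℝ => N / t) atTop (𝓝 0) := tendsto_const_nhds.div_atTop tendsto_id
    have h2 : Tendsto (fun t : ℝ => 1 / (N * t)) atTop (𝓝 0) :=
      tendsto_const_nhds.div_atTop (tendsto_id.const_mul_atTop hN)
    have h3 := ((Real.continuous_exp.tendsto _).comp h1.neg).mul (h2.add_const (1 / N ^ 2))
    simpa using h3
  rw [integral_Ioi_of_hasDerivAt_of_nonneg' hd _ ht]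
  · simp [heatTail]
  · intro t ht
    have : (0 : ℝ) < t := one_pos.trans ht
    positivity

lemma latticeFourier_shortKernel {ν : Fin d → ℤ} (hν : ν ≠ 0) :
    latticeFourier (shortKernel (d := d)) ν =
      ((1 / (‖latticePt ν‖ ^ 2) ^ 2 - heatTail (‖latticePt ν‖ ^ 2) : ℝ) : ℂ) := by
  have hN : 0 < ‖latticePt ν‖ ^ 2 := by
    have := one_le_norm_latticePt hν
    positivity
  set k : ℝ × 𝔼 → ℝ := fun p => p.1 ^ (((d : ℝ) - 4) / 2 - 1) *
      Real.exp (-(Real.pi ^ 2 * ‖p.2‖ ^ 2) * p.1) with hk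
  have hint : Integrable (fun p : ℝ × 𝔼 => (k p : ℂ) * torusChar (-ν) p.2)
      ((volume.restrict (Set.Ioi (1 : ℝ))).prod volume) :=
    integrable_shortKernel_prod.ofReal.mul_bdd (c := 1) (by
      have := continuous_torusChar (-ν)
      fun_prop) (Eventually.of_forall fun p => by simp)
  have h1 : ∀ y : 𝔼, (shortKernel y : ℂ) * torusChar (-ν) y =
      ((Real.pi ^ ((d : ℝ) / 2) : ℝ) : ℂ) *
        ∫ t in Set.Ioi (1 : ℝ), (k (t, y) : ℂ) * torusChar (-ν) y := by
    intro y
    rw [integral_mul_const, integral_complex_ofReal, ← mul_assoc, ← Complex.ofReal_mul]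
    rfl
  simp_rw [latticeFourier, h1]
  rw [integral_const_mul, ← integral_integral_swap hint]
  have h2 : ∀ t ∈ Set.Ioi (1 : ℝ), ∫ y : 𝔼, (k (t, y) : ℂ) * torusChar (-ν) y =
      (((Real.pi ^ ((d : ℝ) / 2))⁻¹ * (t ^ (-3 : ℝ) * Real.exp (-(‖latticePt ν‖ ^ 2 / t))) : ℝ) :
        ℂ) := by
    intro t ht
    have ht0 : (0 : ℝ) < t := one_pos.trans ht
    have h3 : ∀ y : 𝔼, (k (t, y) : ℂ) * torusChar (-ν) y =
        ((t ^ (((d : ℝ) - 4) / 2 - 1) : ℝ) : ℂ) *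
          ((Real.exp (-(Real.pi ^ 2 * ‖y‖ ^ 2) * t) : ℂ) * torusChar (-ν) y) := fun y => by
      simp only [hk]
      rw [Complex.ofReal_mul, mul_assoc]
    simp_rw [h3]
    rw [integral_const_mul, integral_gaussian_mul_torusChar ht0, latticePt_neg, norm_neg,
      ← Complex.ofReal_mul, ← mul_assoc, rpow_mul_inv_rpow ht0, mul_assoc]
  rw [setIntegral_congr_fun measurableSet_Ioi h2, integral_complex_ofReal, integral_const_mul,
    integral_rpow_mul_exp_neg_div hN, ← Complex.ofReal_mul, mul_inv_cancel_left₀ (by positivity)]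

end ShortRange

end TorusBilaplacian

namespace TorusBilaplacian

open Filter Topology

/-! ### Long heat times: a smooth periodic series, cut off to compact support -/

section LongRange

variable {d : ℕ}

local notation "𝔼" => EuclideanSpace ℝ (Fin d)

open scoped Convolution

/-- A smooth compactly supported function whose lattice translates sum to `1`: the convolution of
the indicator of the cell with a smooth probability density. -/
noncomputable def cellBump (x : 𝔼) : ℝ :=
  ∫ t, (default : ContDiffBump (0 : 𝔼)).normed volume t * (cell d).indicator (fun _ => 1) (x - t)

lemma cellBump_eq_convolution :
    cellBump (d := d) = (default : ContDiffBump (0 : 𝔼)).normed volume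
      ⋆[ContinuousLinearMap.mul ℝ ℝ, volume] (cell d).indicator (fun _ => (1 : ℝ)) := rfl

lemma integrable_indicator_cell : Integrable ((cell d).indicator (fun _ => (1 : ℝ))) :=
  (integrable_indicator_iff measurableSet_cell).2 (integrableOn_const (by simp [volume_cell]))

lemma contDiff_cellBump : ContDiff ℝ ∞ (cellBump (d := d)) := by
  rw [cellBump_eq_convolution]
  exact (ContDiffBump.hasCompactSupport_normed _).contDiff_convolution_left _
    (ContDiffBump.contDiff_normed _) integrable_indicator_cell.locallyIntegrable

lemma hasCompactSupport_cellBump : HasCompactSupport (cellBump (d := d)) := by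
  rw [cellBump_eq_convolution]
  refine (ContDiffBump.hasCompactSupport_normed _).convolution _ ?_
  refine HasCompactSupport.intro (isCompact_closedBall (0 : 𝔼) d) fun x hx => ?_
  exact Set.indicator_of_notMem (fun h => hx (cell_subset_closedBall h)) _

lemma setIntegral_cell_torusChar (ν : Fin d → ℤ) :
    ∫ x in cell d, torusChar ν x = if ν = 0 then 1 else 0 := by
  split_ifs with h
  · subst h
    simp [volume_cell, Measure.real]
  -- Differentiating along `ν` itself multiplies the character by `2πi ‖ν‖² ≠ 0`, so its integral
  -- must vanish.
  · have h1 := setIntegral_cell_fderiv (contDiff_torusChar ν) (fun x w => torusChar_periodic ν w x)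
      (latticePt ν)
    simp_rw [fderiv_torusChar] at h1
    rw [integral_const_mul, real_inner_self_eq_norm_sq] at h1
    refine (mul_eq_zero.1 h1).resolve_left ?_
    have h2 : ‖latticePt ν‖ ≠ 0 := (one_pos.trans_le (one_le_norm_latticePt h)).ne'
    have h3 : (((‖latticePt ν‖ ^ 2 : ℝ)) : ℂ) ≠ 0 := by exact_mod_cast pow_ne_zero 2 h2
    exact mul_ne_zero Complex.two_pi_I_ne_zero h3

/-- The transform of a convolution is a product. The factor of the cell vanishes for `ν ≠ 0` by
orthogonality of characters; at `ν = 0` both factors have mass one. -/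
lemma integral_cellBump_mul_torusChar (ν : Fin d → ℤ) :
    ∫ x : 𝔼, (cellBump x : ℂ) * torusChar ν x = if ν = 0 then 1 else 0 := by
  set b : 𝔼 → ℝ := (default : ContDiffBump (0 : 𝔼)).normed volume with hb
  set χ : 𝔼 → ℝ := (cell d).indicator (fun _ => (1 : ℝ)) with hχ
  have hbi : Integrable b := (ContDiffBump.continuous_normed _).integrable_of_hasCompactSupport
    (ContDiffBump.hasCompactSupport_normed _)
  have hF : Integrable fun x => (b x : ℂ) * torusChar ν x :=
    hbi.ofReal.mul_bdd (c := 1) (continuous_torusChar ν).aestronglyMeasurable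
      (Eventually.of_forall fun x => by simp)
  have hG : Integrable fun x => (χ x : ℂ) * torusChar ν x :=
    integrable_indicator_cell.ofReal.mul_bdd (c := 1)
      (continuous_torusChar ν).aestronglyMeasurable (Eventually.of_forall fun x => by simp)
  have h := integral_convolution (ContinuousLinearMap.mul ℂ ℂ) (μ := volume) (ν := volume) hF hG
  have h1 : ∀ x : 𝔼, ((fun x => (b x : ℂ) * torusChar ν x)
      ⋆[ContinuousLinearMap.mul ℂ ℂ, volume] fun x => (χ x : ℂ) * torusChar ν x) x =
      (cellBump x : ℂ) * torusChar ν x := by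
    intro x
    rw [convolution_def, cellBump, ← integral_complex_ofReal, ← integral_mul_const]
    refine integral_congr_ae (Eventually.of_forall fun t => ?_)
    have : torusChar ν x = torusChar ν t * torusChar ν (x - t) := by
      rw [← torusChar_add_apply, add_sub_cancel]
    simp only [ContinuousLinearMap.mul_apply', this, Complex.ofReal_mul]
    ring
  simp_rw [h1] at h
  rw [h, ContinuousLinearMap.mul_apply']
  have h2 : ∫ x, (χ x : ℂ) * torusChar ν x = if ν = 0 then 1 else 0 := by
    rw [← setIntegral_cell_torusChar, ← integral_indicator measurableSet_cell]
    refine integral_congr_ae (Eventually.of_forall fun x => ?_)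
    by_cases hx : x ∈ cell d <;> simp [χ, hx]
  rw [h2]
  split_ifs with h0
  · subst h0
    simp only [torusChar_zero, mul_one]
    rw [integral_complex_ofReal, ContDiffBump.integral_normed]
    simp
  · simp

lemma iteratedDeriv_exp_mul_I (n : ℕ) :
    iteratedDeriv n (fun t : ℝ => Complex.exp (t * Complex.I)) =
      fun t : ℝ => Complex.I ^ n * Complex.exp (t * Complex.I) := by
  induction n with
  | zero => simp
  | succ n ih =>
    rw [iteratedDeriv_succ, ih]
    funext t
    have h1 : HasDerivAt (fun t : ℝ => (t : ℂ) * Complex.I) Complex.I t := by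
      simpa using (Complex.ofRealCLM.hasDerivAt (x := t)).mul_const Complex.I
    have h2 := (h1.cexp).const_mul (Complex.I ^ n)
    rw [h2.deriv]
    ring

lemma norm_iteratedFDeriv_torusChar_le (ν : Fin d → ℤ) (n : ℕ) (x : 𝔼) :
    ‖iteratedFDeriv ℝ n (torusChar ν) x‖ ≤ (2 * Real.pi * ‖latticePt ν‖) ^ n := by
  set L : 𝔼 →L[ℝ] ℝ := (2 * Real.pi) • innerSL ℝ (latticePt ν) with hL
  have hf : ContDiff ℝ n (fun t : ℝ => Complex.exp (t * Complex.I)) :=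
    (Complex.ofRealCLM.contDiff.mul contDiff_const).cexp
  have h1 : torusChar ν = (fun t : ℝ => Complex.exp (t * Complex.I)) ∘ L := by
    funext y
    rw [torusChar_eq_exp_mul_I]
    simp [L]
  rw [h1, L.iteratedFDeriv_comp_right hf x le_rfl]
  refine (ContinuousMultilinearMap.norm_compContinuousLinearMap_le _ _).trans ?_
  rw [norm_iteratedFDeriv_eq_norm_iteratedDeriv, iteratedDeriv_exp_mul_I, norm_mul, norm_pow,
    Complex.norm_I, one_pow, Complex.norm_exp_ofReal_mul_I, one_mul, one_mul, Finset.prod_const,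
    Finset.card_univ, Fintype.card_fin, hL, norm_smul, innerSL_apply_norm,
    Real.norm_of_nonneg (by positivity)]

lemma heatTail_nonneg {N : ℝ} (hN : 0 ≤ N) : 0 ≤ heatTail N := by
  unfold heatTail; positivity

lemma summable_heatTail_mul_pow (k : ℕ) :
    Summable fun ν : Fin d → ℤ => heatTail (‖latticePt ν‖ ^ 2) * ‖latticePt ν‖ ^ k := by
  have hs := (summable_norm_add_latticePt (n := d + 1) (by lia) (0 : 𝔼)).mul_left
    (2 * ((k + d + 1).factorial : ℝ))
  refine Summable.of_nonneg_of_le (fun ν => ?_) (fun ν => ?_) hs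
  · have := heatTail_nonneg (sq_nonneg ‖latticePt ν‖)
    positivity
  by_cases hν : ν = 0
  · subst hν
    -- Division by zero gives `heatTail 0 = 0`, so the full lattice sum carries no constant mode.
    simp [heatTail]
  rw [zero_add]
  have h1 := one_le_norm_latticePt hν
  set r := ‖latticePt ν‖
  have hr : 0 < r := one_pos.trans_le h1
  -- The exponent `k + d + 1` pays for the factor `r ^ k` and leaves `r⁻¹ ^ (d + 1)`, summable over
  -- the lattice.
  have h2 := Real.pow_div_factorial_le_exp (x := r ^ 2) (by positivity) (k + d + 1)
  have h3 : r ^ (k + d + 1) ≤ (r ^ 2) ^ (k + d + 1) := by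
    gcongr
    nlinarith
  have h4 : Real.exp (-r ^ 2) ≤ (k + d + 1).factorial * (r ^ (k + d + 1))⁻¹ := by
    rw [Real.exp_neg, inv_le_comm₀ (by positivity) (by positivity), mul_inv, inv_inv]
    refine le_trans ?_ h2
    rw [div_eq_inv_mul]
    gcongr
  have h5 : 1 / r ^ 2 + 1 / (r ^ 2) ^ 2 ≤ 2 := by
    have h6 : 1 / r ^ 2 ≤ 1 := by
      rw [div_le_one (by positivity)]; nlinarith
    have h7 : 1 / (r ^ 2) ^ 2 ≤ 1 := by
      rw [div_le_one (by positivity)]; exact one_le_pow₀ (one_le_pow₀ h1)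
    linarith
  calc heatTail (r ^ 2) * r ^ k
      ≤ ((k + d + 1).factorial * (r ^ (k + d + 1))⁻¹) * 2 * r ^ k := by
        unfold heatTail
        gcongr
    _ = 2 * ((k + d + 1).factorial : ℝ) * r⁻¹ ^ (d + 1) := by
        rw [add_assoc, pow_add r k, inv_pow]
        field_simp

/-- The periodic function with the Fourier coefficients `heatTail (‖ν‖²)`. -/
noncomputable def longSeries (x : 𝔼) : ℂ :=
  ∑' ν : Fin d → ℤ, (heatTail (‖latticePt ν‖ ^ 2) : ℂ) * torusChar ν x

lemma contDiff_longSeries : ContDiff ℝ ∞ (longSeries (d := d)) := by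
  refine contDiff_tsum
    (v := fun k ν => (2 * Real.pi) ^ k * (heatTail (‖latticePt ν‖ ^ 2) * ‖latticePt ν‖ ^ k))
    (fun ν => contDiff_const.mul (contDiff_torusChar ν))
    (fun k _ => (summable_heatTail_mul_pow k).mul_left _) fun k ν x _ => ?_
  have h1 : (fun x : 𝔼 => (heatTail (‖latticePt ν‖ ^ 2) : ℂ) * torusChar ν x) =
      (heatTail (‖latticePt ν‖ ^ 2)) • torusChar ν := by
    funext y
    simp
  have h0 := heatTail_nonneg (sq_nonneg ‖latticePt ν‖)
  rw [h1, iteratedFDeriv_const_smul_apply (contDiff_torusChar ν).contDiffAt, norm_smul,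
    Real.norm_of_nonneg h0, mul_left_comm, ← mul_pow]
  gcongr
  exact norm_iteratedFDeriv_torusChar_le ν k x

/-- The coefficients are real and even in `ν`. -/
lemma longSeries_eq_re (x : 𝔼) : (((longSeries x).re : ℝ) : ℂ) = longSeries x := by
  rw [← Complex.conj_eq_iff_re, longSeries, Complex.conj_tsum, ← (Equiv.neg _).tsum_eq]
  refine tsum_congr fun ν => ?_
  simp [torusChar_neg, latticePt_neg]

/-- The part of the kernel of `Δ⁻²` contributed by heat times at least `1`, cut off to a compactly
supported function with the same Fourier transform at the lattice points. -/
noncomputable def longKernel (x : 𝔼) : ℝ := (longSeries x).re * cellBump x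

lemma contDiff_longKernel : ContDiff ℝ ∞ (longKernel (d := d)) :=
  (Complex.reCLM.contDiff.comp contDiff_longSeries).mul contDiff_cellBump

lemma hasCompactSupport_longKernel : HasCompactSupport (longKernel (d := d)) :=
  hasCompactSupport_cellBump.mul_left

lemma integrable_cellBump : Integrable (cellBump (d := d)) :=
  contDiff_cellBump.continuous.integrable_of_hasCompactSupport hasCompactSupport_cellBump

lemma integrable_longKernel : Integrable (longKernel (d := d)) :=
  contDiff_longKernel.continuous.integrable_of_hasCompactSupport hasCompactSupport_longKernel

lemma summable_longKernel {x : 𝔼} (hx : ∀ w : Fin d → ℤ, x ≠ latticePt w) :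
    Summable fun w : Fin d → ℤ => longKernel (x + latticePt w) := by
  obtain ⟨C, hC⟩ := (hasCompactSupport_longKernel (d := d)).mul_left
    (f := fun y => ‖y‖ ^ (d + 1)) |>.exists_bound_of_continuous
    ((continuous_norm.pow _).mul contDiff_longKernel.continuous)
  refine Summable.of_norm_bounded
    ((summable_norm_add_latticePt (Nat.lt_succ_self d) x).mul_left C) fun w => ?_
  have h0 : x + latticePt w ≠ 0 := fun h => hx (-w) (by
    rw [latticePt_neg]; exact eq_neg_of_add_eq_zero_left h)
  have h1 : 0 < ‖x + latticePt w‖ := norm_pos_iff.2 h0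
  have h2 := hC (x + latticePt w)
  rw [Pi.mul_apply, norm_mul, norm_pow, norm_norm] at h2
  rwa [inv_pow, ← div_eq_mul_inv, le_div_iff₀' (by positivity)]

/-- Against the character `-ν`, the mode `μ` of the series contributes the transform of `cellBump`
at `μ - ν`, so only `μ = ν` survives. -/
lemma latticeFourier_longKernel (ν : Fin d → ℤ) :
    latticeFourier (longKernel (d := d)) ν = ((heatTail (‖latticePt ν‖ ^ 2) : ℝ) : ℂ) := by
  have hτ : Summable fun ν : Fin d → ℤ => heatTail (‖latticePt ν‖ ^ 2) := by
    simpa using summable_heatTail_mul_pow (d := d) 0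
  have hi : ∀ μ : Fin d → ℤ, Integrable fun y : 𝔼 => (heatTail (‖latticePt μ‖ ^ 2) : ℂ) *
      ((cellBump y : ℂ) * torusChar (μ + -ν) y) := fun μ =>
    (integrable_cellBump.ofReal.mul_bdd (c := 1)
      (continuous_torusChar (μ + -ν)).aestronglyMeasurable
      (Eventually.of_forall fun y => by simp)).const_mul _
  have h := hasSum_integral_of_summable_integral_norm hi ?_
  · simp_rw [integral_const_mul, integral_cellBump_mul_torusChar] at h
    have h1 := hasSum_single (f := fun μ : Fin d → ℤ => (heatTail (‖latticePt μ‖ ^ 2) : ℂ) *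
      if μ + -ν = 0 then 1 else 0) ν (fun μ hμ => by
        rw [if_neg (fun h => hμ (by rwa [← sub_eq_add_neg, sub_eq_zero] at h)), mul_zero])
    have h2 := h.unique h1
    rw [if_pos (add_neg_cancel ν), mul_one] at h2
    rw [← h2]
    refine integral_congr_ae (Eventually.of_forall fun y => ?_)
    simp only [longKernel, Complex.ofReal_mul, longSeries_eq_re]
    rw [longSeries, mul_assoc, ← tsum_mul_right]
    refine tsum_congr fun μ => ?_
    rw [torusChar_add]
    ring
  · simp only [norm_mul, norm_torusChar, mul_one, Complex.norm_real]
    simp_rw [integral_const_mul]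
    exact hτ.norm.mul_right _

end LongRange

end TorusBilaplacian

namespace TorusBilaplacian

open Filter Topology

/-! ### The Green kernel: singular part, smooth part and symbol -/

section Green

variable {d : ℕ}

local notation "𝔼" => EuclideanSpace ℝ (Fin d)

/-- An integrable function on `ℝ^d` whose periodization is the kernel of `Δ⁻²`. -/
noncomputable def greenKernel (x : 𝔼) : ℝ := shortKernel x + longKernel x

/-- The smooth part of `greenKernel`. -/
noncomputable def smoothPart (x : 𝔼) : ℝ :=
  longKernel x - Real.pi ^ ((d : ℝ) / 2) * lowerGamma (((d : ℝ) - 4) / 2) (‖x‖ ^ 2)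

lemma integrable_greenKernel : Integrable (greenKernel (d := d)) :=
  integrable_shortKernel.add integrable_longKernel

lemma contDiff_smoothPart (hd : 5 ≤ d) : ContDiff ℝ ∞ (smoothPart (d := d)) := by
  have hd' : (5 : ℝ) ≤ d := by exact_mod_cast hd
  exact contDiff_longKernel.sub (contDiff_const.mul
    ((contDiff_lowerGamma (by linarith)).comp (contDiff_norm_sq ℝ)))

lemma greenKernel_eq (hd : 5 ≤ d) {x : 𝔼} (hx : x ≠ 0) :
    greenKernel x = Real.pi ^ (4 - (d : ℝ) / 2) * Real.Gamma (((d : ℝ) - 4) / 2) *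
      ‖x‖ ^ (4 - (d : ℝ)) + smoothPart x := by
  have hd' : (5 : ℝ) ≤ d := by exact_mod_cast hd
  have hn : 0 < ‖x‖ := norm_pos_iff.2 hx
  have h := lowerGamma_add_upperGamma (a := ((d : ℝ) - 4) / 2) (y := ‖x‖ ^ 2) (by linarith)
    (by positivity)
  -- The power of `π` is `d/2 - (d - 4) = 4 - d/2`, which gives the constant in the statement.
  have h1 : Real.pi ^ ((d : ℝ) / 2) * (1 / (Real.pi ^ 2 * ‖x‖ ^ 2)) ^ (((d : ℝ) - 4) / 2) =
      Real.pi ^ (4 - (d : ℝ) / 2) * ‖x‖ ^ (4 - (d : ℝ)) := by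
    rw [← mul_pow, one_div, ← Real.rpow_natCast (Real.pi * ‖x‖) 2, ← Real.rpow_neg (by positivity),
      ← Real.rpow_mul (by positivity), Real.mul_rpow Real.pi_pos.le hn.le, ← mul_assoc,
      ← Real.rpow_add Real.pi_pos]
    congr 2 <;> push_cast <;> ring
  rw [greenKernel, smoothPart, shortKernel]
  linear_combination Real.pi ^ ((d : ℝ) / 2) * h + Real.Gamma (((d : ℝ) - 4) / 2) * h1

lemma latticeFourier_greenKernel {ν : Fin d → ℤ} (hν : ν ≠ 0) :
    latticeFourier (greenKernel (d := d)) ν =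
      ((‖latticePt ν‖ ^ (2 * (-2) : ℝ) : ℝ) : ℂ) := by
  have hi : ∀ {g : 𝔼 → ℝ}, Integrable g →
      Integrable fun y => (g y : ℂ) * torusChar (-ν) y := fun hg =>
    hg.ofReal.mul_bdd (c := 1) (continuous_torusChar (-ν)).aestronglyMeasurable
      (Eventually.of_forall fun y => by simp)
  have h : latticeFourier (greenKernel (d := d)) ν =
      latticeFourier (shortKernel (d := d)) ν + latticeFourier (longKernel (d := d)) ν := by
    simp only [latticeFourier, greenKernel, Complex.ofReal_add, add_mul]
    exact integral_add (hi integrable_shortKernel) (hi integrable_longKernel)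
  rw [h, latticeFourier_shortKernel hν, latticeFourier_longKernel, ← Complex.ofReal_add,
    sub_add_cancel, show (2 * (-2) : ℝ) = -((4 : ℕ) : ℝ) by norm_num,
    Real.rpow_neg (norm_nonneg _), Real.rpow_natCast, one_div, ← pow_mul]

end Green

end TorusBilaplacian

theorem theorem3 (d : ℕ) (hd : 5 ≤ d) :
    ∃ (G h : EuclideanSpace ℝ (Fin d) → ℝ),
      Integrable G ∧
      ContDiff ℝ ∞ h ∧
      (∀ x : EuclideanSpace ℝ (Fin d), x ≠ 0 →
        G x = Real.pi ^ (4 - (d : ℝ) / 2) * Real.Gamma (((d : ℝ) - 4) / 2) *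
          ‖x‖ ^ (4 - (d : ℝ)) + h x) ∧
      (∀ x : EuclideanSpace ℝ (Fin d), (∀ w : Fin d → ℤ, x ≠ TorusBilaplacian.latticePt w) →
        Summable fun w : Fin d → ℤ => G (x + TorusBilaplacian.latticePt w)) ∧
      ∀ u : TorusBilaplacian.ZeroAvgSmooth d,
        IntegrableOn
          (fun p : EuclideanSpace ℝ (Fin d) × EuclideanSpace ℝ (Fin d) =>
            u.1 p.1 * u.1 p.2 *
              ∑' w : Fin d → ℤ, G (p.1 - p.2 + TorusBilaplacian.latticePt w))
          (TorusBilaplacian.cell d ×ˢ TorusBilaplacian.cell d) ∧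
        TorusBilaplacian.invBilaplacianForm u.1 =
          ((∫ p in TorusBilaplacian.cell d ×ˢ TorusBilaplacian.cell d,
            u.1 p.1 * u.1 p.2 *
              ∑' w : Fin d → ℤ, G (p.1 - p.2 + TorusBilaplacian.latticePt w) : ℝ) : ℂ) ∧
        ∀ (Ω : Type*) [MeasurableSpace Ω] (P : Measure Ω) [IsProbabilityMeasure P]
          (Ξ : TorusBilaplacian.ZeroAvgSmooth d → Ω → ℝ),
          TorusBilaplacian.IsBilaplacianField P Ξ →
            Integrable (fun o => Ξ u o ^ 2) P ∧
            ((∫ o, Ξ u o ^ 2 ∂P : ℝ) : ℂ) = TorusBilaplacian.invBilaplacianForm u.1 := by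
  refine ⟨TorusBilaplacian.greenKernel, TorusBilaplacian.smoothPart,
    TorusBilaplacian.integrable_greenKernel, TorusBilaplacian.contDiff_smoothPart hd,
    fun x hx => TorusBilaplacian.greenKernel_eq hd hx,
    fun x hx => (TorusBilaplacian.summable_shortKernel hx).add
      (TorusBilaplacian.summable_longKernel hx), fun u => ?_⟩
  obtain ⟨h1, h2⟩ := TorusBilaplacian.invBilaplacianForm_eq_periodization
    TorusBilaplacian.integrable_greenKernel
    (fun _ hν => TorusBilaplacian.latticeFourier_greenKernel hν) u
  exact ⟨h1, h2, fun _ _ _ _ _ hΞ => hΞ.integral_sq u⟩
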